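/- **Conventions.** A $C^*$-category $\mathfrak C$ (possibly without units, with a class of objects and sets of morphisms) has complex Banach spaces of morphisms $\mathfrak C(A,B)$, an associative bilinear composition with $\|gf\|\le\|g\|\|f\|$, and an isometric antilinear contravariant involution $*$ which fixes the objects, such that for all $f\in\mathfrak C(A,B)$ one has $\|f^*f\|=\|f\|^2$ and $f^*f$ is positive in $\mathfrak C(A,A)$ (i.e. $f^*f=b^*b$ with $b\in\mathfrak C(A,A)$). A $C^*$-functor is a $\mathbb C$-linear functor of non-unital categories that preserves $*$; it is called unital if it preserves units. A *unitary* is a morphism $u$ of a unital $C^*$-category with $u^*u=1$ and $uu^*=1$. A Hilbert $\mathfrak C$-module $H$ consists of complex Banach spaces $H(A)$, $A\in\mathfrak C$, a bilinear contravariant action $H(A)\times\mathfrak C(B,A)\to H(B)$, $(a,f)\mapsto af$, and scalar products $\langle b,a\rangle\in\mathfrak C(A,B)$ for $a\in H(A)$, $b\in H(B)$, linear in $a$, with $\langle b,a\rangle=\langle a,b\rangle^*$, $\langle b,af\rangle=\langle b,a\rangle f$, $\langle a,a\rangle$ positive and $\|a\|^2=\|\langle a,a\rangle\|$. A *bounded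 linear map* $f:H\to H'$ is a natural family of linear maps $f_A:H(A)\to H'(A)$ with $\sup_A\|f_A\|<\infty$; an *operator* is a bounded linear map $f$ which has an adjoint $f^*:H'\to H$, $\langle h,f^*k\rangle=\langle f h,k\rangle$. A Hilbert module is *small* if it is endowed with a set of generators $x\in H(A_x)$, i.e. for all $A$ the finite sums of elements $xg$ with $g\in\mathfrak C(A,A_x)$ are dense in $H(A)$. Small Hilbert modules and operators, with norm $\sup_A\|f_A\|$, form a unital $C^*$-category $\mathcal H\mathfrak C$. The Yoneda embedding $\mathbb Y:\mathfrak C\to\mathcal H\mathfrak C$ sends $A$ to $\mathbb Y_A=\mathfrak C(-,A)$ with $\langle u,v\rangle=u^*v$, generated by $\mathfrak C(A,A)$. Every $a\in H(A)$ gives an operator $\hat a:\mathbb Y_A\to H$, $f\mapsto af$. For a $C^*$-functor $f:\mathfrak C\to\mathfrak D$, the $C^*$-functor $\mathcal Hf:\mathcal H\mathfrak C\to\mathcal H\mathfrak D$ is characterised, up to a unique unitary isomorphism, as follows: for $H$ with generators $x\in H(A_x)$, the module $(\mathcal Hf)H$ has elements $f_x$ over $f(A_x)$ which generate it, with $\langle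 f_x,f_y\rangle=f(\langle x,y\rangle)$; and for an operator $h:H\to H'$ and generators $x$ of $H$, $y$ of $H'$, $\langle f_y,(\mathcal Hf)(h)f_x\rangle=f(\langle y,h x\rangle)$. A *pre-complete structure* on a unital $C^*$-category $\mathfrak C$ is a unital $C^*$-functor $L:\mathcal H\mathfrak C\to\mathfrak C$ with a natural unitary isomorphism $\eta:\mathrm{Id}\simeq L\circ\mathbb Y$. It gives, for each $H\in\mathcal H\mathfrak C$, an embedding $H\hookrightarrow\mathbb Y_{LH}$ sending $a\in H(A)$ to $i(a)=L(\hat a)\circ\eta_A: A\to LH$. A *hereditary subalgebra* $\mathcal A\subset\mathfrak C(X,X)$ is a norm-closed $*$-subalgebra with $\mathcal A\,\mathfrak C(X,X)\,\mathcal A\subset\mathcal A$; $\mathcal A X\subset\mathbb Y_X$ denotes the small Hilbert submodule given by the closed linear spans of the $ah$ with $a\in\mathcal A$, $h\in\mathfrak C(Z,X)$, with $\mathcal A$ as generators. $\mathcal A$ is *weakly dense* if there is a unitary $u:L(\mathcal AX)\to X$ with $u\circ i(h)=h$ for all elements $h$ of $\mathcal AX$. A unital $C^*$-functor $f:(\mathfrak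 C,L,\eta)\to(\mathfrak D,L',\eta')$ is *continuous* if there is a natural unitary isomorphism $\theta:f\circ L\simeq L'\circ\mathcal Hf$ which on representable modules is the canonical one, i.e. $\theta_{\mathbb Y_A}\circ f(\eta_A)$ is the image $i'(f_{1_A})$ in $L'((\mathcal H f)\mathbb Y_A)$ of the element $f_{1_A}$ over $f(A)$, for all $A\in\mathfrak C$. One considers the conditions: * (C1) For all $H\in\mathcal H\mathfrak C$ and $\lambda:LH\to A$ in $\mathfrak C$, if $\lambda\circ i(b)=0$ for all elements $b$ of $H$, then $\lambda=0$. * (C2) $L:\mathcal H\mathfrak C\to\mathfrak C$ is continuous, where $\mathcal H\mathfrak C$ carries the restriction structure described below. * (C3) For every object $X$ and all hereditary subalgebras $\mathcal A\subset\mathcal B\subset\mathfrak C(X,X)$, if $\mathcal A$ is weakly dense then so is $\mathcal B$. * (C4) For all $A,B\in\mathcal H\mathfrak C$ and all bounded linear maps $f:A\to\mathbb Y_{LB}$, $g:B\to\mathbb Y_{LA}$ such that $\langle f(a),i(b)\rangle=\langle i(a),g(b)\rangle$ for all elements $a$ of $A$ and $b$ of $B$, there is an operator $\tilde f:\mathbb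 Y_{LA}\to\mathbb Y_{LB}$ with $\tilde f(i(a))=f(a)$ for all elements $a$ of $A$. **Restriction structure.** Let $\mathfrak C$ be a (possibly non-unital) $C^*$-category. For $V\in\mathcal H\mathcal H\mathfrak C$ let $R(V)$ be given by $$R(V)(c)=\{v\in V(\mathbb Y_c)\;:\;\langle v,v\rangle=\mathbb Y(g)\text{ for some } g\in\mathfrak C(c,c)\},\qquad c\in\mathfrak C,$$ with the action $v\cdot g=v\,\mathbb Y(g)$ and the scalar product with $\mathbb Y(\langle v,w\rangle_{R(V)})=\langle v,w\rangle_V$; operators are sent to their restrictions; and for $H\in\mathcal H\mathfrak C$ let $H\to R(\mathbb Y_H)$ be the Yoneda map $m\mapsto\hat m$. **Theorem.** For every $C^*$-category $\mathfrak C$: 1. There is a pre-complete structure on $\mathcal H\mathfrak C$ given by this restriction, i.e. a functor $L:\mathcal H\mathcal H\mathfrak C\to\mathcal H\mathfrak C$ with a unitary isomorphism $\mathrm{Id}\simeq L\circ\mathbb Y$, which are the functor $R$ and the Yoneda isomorphism up to a natural isomorphism $L(V)\simeq R(V)$ preserving actions and scalar products. 2. Every such pre-complete structure on $\mathcal H\mathfrak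 C$ satisfies (C1), (C2), (C3) and (C4). -/

import Mathlib

open scoped ENNReal

universe u v w

noncomputable section

/-- A (possibly non-unital) Banach `*`-category with objects `C`: the spaces of morphisms are complex
Banach spaces in the universe `Type v` of sets, while the objects may form a proper class. -/
class BanachStarCategory (C : Type u) where
  Hom : C → C → Type v
  [normedAddCommGroup : ∀ A B, NormedAddCommGroup (Hom A B)]
  [normedSpace : ∀ A B, NormedSpace ℂ (Hom A B)]
  [completeSpace : ∀ A B, CompleteSpace (Hom A B)]
  /-- `comp g f` is `g ∘ f`. -/
  comp : ∀ {A B D : C}, Hom B D → Hom A B → Hom A D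
  /-- `adj f` is `f^*`. -/
  adj : ∀ {A B : C}, Hom A B → Hom B A
  comp_assoc : ∀ {A B D E : C} (h : Hom D E) (g : Hom B D) (f : Hom A B),
    comp (comp h g) f = comp h (comp g f)
  comp_add : ∀ {A B D : C} (g : Hom B D) (f f' : Hom A B),
    comp g (f + f') = comp g f + comp g f'
  add_comp : ∀ {A B D : C} (g g' : Hom B D) (f : Hom A B),
    comp (g + g') f = comp g f + comp g' f
  comp_smul : ∀ {A B D : C} (c : ℂ) (g : Hom B D) (f : Hom A B),
    comp g (c • f) = c • comp g f
  smul_comp : ∀ {A B D : C} (c : ℂ) (g : Hom B D) (f : Hom A B),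
    comp (c • g) f = c • comp g f
  norm_comp_le : ∀ {A B D : C} (g : Hom B D) (f : Hom A B), ‖comp g f‖ ≤ ‖g‖ * ‖f‖
  adj_adj : ∀ {A B : C} (f : Hom A B), adj (adj f) = f
  adj_comp : ∀ {A B D : C} (g : Hom B D) (f : Hom A B), adj (comp g f) = comp (adj f) (adj g)
  adj_add : ∀ {A B : C} (f f' : Hom A B), adj (f + f') = adj f + adj f'
  adj_smul : ∀ {A B : C} (c : ℂ) (f : Hom A B), adj (c • f) = star c • adj f
  norm_adj : ∀ {A B : C} (f : Hom A B), ‖adj f‖ = ‖f‖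

attribute [reducible, instance] BanachStarCategory.normedAddCommGroup BanachStarCategory.normedSpace
attribute [instance] BanachStarCategory.completeSpace

open BanachStarCategory

/-- Composition of morphisms: `g ⊚ f` is `g` after `f`. -/
infixr:80 " ⊚ " => BanachStarCategory.comp

namespace BanachStarCategory

variable {C : Type u} [BanachStarCategory.{u, v} C]

lemma adj_zero {A B : C} : adj (0 : Hom A B) = 0 := by
  have := adj_smul (0 : ℂ) (0 : Hom A B)
  simpa using this

lemma adj_neg {A B : C} (f : Hom A B) : adj (-f) = -adj f := by
  have := adj_smul (-1 : ℂ) f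
  simpa using this

lemma adj_sub {A B : C} (f g : Hom A B) : adj (f - g) = adj f - adj g := by
  rw [sub_eq_add_neg, adj_add, adj_neg, ← sub_eq_add_neg]

lemma comp_zero {A B D : C} (g : Hom B D) : g ⊚ (0 : Hom A B) = 0 := by
  have := BanachStarCategory.comp_smul (0 : ℂ) g (0 : Hom A B)
  simpa using this

lemma zero_comp {A B D : C} (f : Hom A B) : (0 : Hom B D) ⊚ f = 0 := by
  have := BanachStarCategory.smul_comp (0 : ℂ) (0 : Hom B D) f
  simpa using this

/-- The `C^*`-algebra of endomorphisms of an object. -/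
abbrev endAlgebra (A : C) (hA : ∀ f : Hom A A, ‖adj f ⊚ f‖ = ‖f‖ ^ 2) :
    NonUnitalCStarAlgebra (Hom A A) :=
  { (inferInstance : NormedAddCommGroup (Hom A A)), (inferInstance : NormedSpace ℂ (Hom A A)),
    (inferInstance : CompleteSpace (Hom A A)) with
    mul := fun f g => f ⊚ g
    star := fun f => adj f
    left_distrib := fun f g h => comp_add f g h
    right_distrib := fun f g h => add_comp f g h
    zero_mul := fun f => zero_comp f
    mul_zero := fun f => comp_zero f
    mul_assoc := fun f g h => comp_assoc f g h
    norm_mul_le := fun f g => norm_comp_le f g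
    star_involutive := fun f => adj_adj f
    star_mul := fun f g => adj_comp f g
    star_add := fun f g => adj_add f g
    norm_mul_self_le := fun f => by
      have := hA f
      rw [sq] at this
      exact this.ge
    smul_assoc := fun c f g => smul_comp c f g
    smul_comm := fun c f g => (comp_smul c f g).symm
    star_smul := fun c f => adj_smul c f }

end BanachStarCategory

/-- An endomorphism `a` is positive if it has the form `b^* b` with `b` an endomorphism of the same
object. -/
def IsPositiveEnd {C : Type u} [BanachStarCategory.{u, v} C] {A : C} (a : Hom A A) : Prop :=
  ∃ b : Hom A A, a = adj b ⊚ b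

/-- A (possibly non-unital) `C^*`-category. -/
class CStarCategory (C : Type u) extends BanachStarCategory.{u, v} C where
  norm_adj_comp_self : ∀ {A B : C} (f : Hom A B), ‖comp (adj f) f‖ = ‖f‖ ^ 2
  /-- The endomorphism `f^* f` is positive. -/
  adj_comp_self_pos : ∀ {A B : C} (f : Hom A B), ∃ b : Hom A A, comp (adj f) f = comp (adj b) b

open CStarCategory

/-- The structure of a unital category on a `C^*`-category. -/
class UnitalCStarCategory (C : Type u) extends CStarCategory.{u, v} C where
  one : ∀ A : C, Hom A A
  one_comp : ∀ {A B : C} (f : Hom A B), comp (one B) f = f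
  comp_one : ∀ {A B : C} (f : Hom A B), comp f (one A) = f

/-- A Hilbert module over a `C^*`-category. The norm of `a` is required to be `‖⟨a, a⟩‖^{1/2}`, and
the module is complete and separated for it. -/
structure HilbertModule (C : Type u) [CStarCategory.{u, v} C] where
  Elem : C → Type v
  [normedAddCommGroup : ∀ A, NormedAddCommGroup (Elem A)]
  [normedSpace : ∀ A, NormedSpace ℂ (Elem A)]
  [completeSpace : ∀ A, CompleteSpace (Elem A)]
  /-- The contravariant action: `act a f` is `a ∘ f`. -/
  act : ∀ {A B : C}, Elem A → Hom B A → Elem B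
  /-- The scalar product `⟨b, a⟩`, linear in `a`. -/
  inner : ∀ {A B : C}, Elem B → Elem A → Hom A B
  act_add : ∀ {A B : C} (a : Elem A) (f g : Hom B A), act a (f + g) = act a f + act a g
  add_act : ∀ {A B : C} (a b : Elem A) (f : Hom B A), act (a + b) f = act a f + act b f
  act_smul : ∀ {A B : C} (c : ℂ) (a : Elem A) (f : Hom B A), act a (c • f) = c • act a f
  smul_act : ∀ {A B : C} (c : ℂ) (a : Elem A) (f : Hom B A), act (c • a) f = c • act a f
  act_comp : ∀ {A B D : C} (a : Elem A) (f : Hom B A) (g : Hom D B),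
    act a (f ⊚ g) = act (act a f) g
  inner_symm : ∀ {A B : C} (b : Elem B) (a : Elem A), inner b a = adj (inner a b)
  inner_add : ∀ {A B : C} (b : Elem B) (a a' : Elem A), inner b (a + a') = inner b a + inner b a'
  inner_smul : ∀ {A B : C} (c : ℂ) (b : Elem B) (a : Elem A), inner b (c • a) = c • inner b a
  inner_act : ∀ {A B D : C} (b : Elem B) (a : Elem A) (f : Hom D A),
    inner b (act a f) = inner b a ⊚ f
  inner_self_pos : ∀ {A : C} (a : Elem A), IsPositiveEnd (inner a a)
  norm_sq : ∀ {A : C} (a : Elem A), ‖a‖ ^ 2 = ‖inner a a‖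

attribute [instance] HilbertModule.normedAddCommGroup HilbertModule.normedSpace
  HilbertModule.completeSpace

/-- A small Hilbert module: a Hilbert module with a chosen set of generators. -/
structure SmallHilbertModule (C : Type u) [CStarCategory.{u, v} C] extends HilbertModule C where
  Gen : Type v
  src : Gen → C
  gen : ∀ x : Gen, Elem (src x)
  /-- The finite sums of elements `gen x ∘ f` are dense. -/
  dense : ∀ A : C, (Submodule.span ℂ
    {a : Elem A | ∃ (x : Gen) (f : Hom A (src x)), a = act (gen x) f}).topologicalClosure = ⊤

namespace CStarCategory

variable {C : Type u} [CStarCategory.{u, v} C]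

/-- Bounded linear maps between Hilbert modules: the families of bounded `ℂ`-linear maps `f_A`,
natural in `A`, with `sup_A ‖f_A‖ < ∞`. The norm is `sup_A ‖f_A‖`. -/
def BoundedMap (M N : HilbertModule C) :
    Submodule ℂ (lp (fun A : C => M.Elem A →L[ℂ] N.Elem A) ∞) where
  carrier := {f | ∀ (A B : C) (a : M.Elem A) (g : Hom B A), f B (M.act a g) = N.act (f A a) g}
  add_mem' := by
    intro f f' hf hf' A B a g
    simp [hf A B a g, hf' A B a g, N.add_act]
  zero_mem' := by
    intro A B a g
    have := N.smul_act 0 (0 : N.Elem A) g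
    simp at this
    simp [this]
  smul_mem' := by
    intro c f hf A B a g
    simp [hf A B a g, N.smul_act]

/-- The value of a bounded linear map on an element. -/
def app {M N : HilbertModule C} (f : BoundedMap M N) {A : C} (a : M.Elem A) : N.Elem A :=
  f.1 A a

/-- `g` is adjoint to `f`; an operator is a bounded linear map which has an adjoint. -/
def IsAdjointPair {M N : HilbertModule C} (f : BoundedMap M N) (g : BoundedMap N M) : Prop :=
  ∀ (A B : C) (h : M.Elem A) (k : N.Elem B), M.inner h (app g k) = N.inner (app f h) k

section basic

lemma norm_adj_conj_le {A : C} (p : Hom A A) (hp : IsPositiveEnd p) (c : Hom A A) :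
    ∀ q : Hom A A, IsPositiveEnd q →
    IsPositiveEnd (q - (2 * ‖p‖ : ℝ) • (adj c ⊚ c) + adj c ⊚ p ⊚ c) →
    ‖p‖ * ‖c‖ ^ 2 ≤ ‖q‖ := by
  let _ := endAlgebra A norm_adj_comp_self
  let _ := CStarAlgebra.spectralOrder (Hom A A)
  let _ := CStarAlgebra.spectralOrderedRing (Hom A A)
  intro q hq h
  have pos : ∀ a : Hom A A, IsPositiveEnd a → 0 ≤ a := by
    rintro a ⟨b, rfl⟩
    exact star_mul_self_nonneg b
  have h1 : star c * p * c ≤ ‖p‖ • (star c * c) :=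
    CStarAlgebra.star_left_conjugate_le_norm_smul (hb := (pos p hp).isSelfAdjoint)
  have h2 := pos _ h
  have e : adj c ⊚ p ⊚ c = star c * p * c := (mul_assoc (star c) p c).symm
  have e' : adj c ⊚ c = star c * c := rfl
  rw [e, e'] at h2
  have h3 : ‖p‖ • (star c * c) ≤ q := by
    have : 0 ≤ q - ‖p‖ • (star c * c) := by
      calc (0 : Hom A A) ≤ _ := h2
        _ ≤ q - (2 * ‖p‖) • (star c * c) + ‖p‖ • (star c * c) := by gcongr
        _ = _ := by rw [two_mul, add_smul]; abel
    exact sub_nonneg.mp this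
  have h4 := CStarAlgebra.norm_le_norm_of_nonneg_of_le
    (smul_nonneg (norm_nonneg p) (star_mul_self_nonneg c)) h3
  rwa [norm_smul, norm_norm, CStarRing.norm_star_mul_self, ← sq] at h4

end basic

end CStarCategory

namespace HilbertModule

open CStarCategory

variable {C : Type u} [CStarCategory.{u, v} C] (M : HilbertModule C)

lemma add_inner {A B : C} (b b' : M.Elem B) (a : M.Elem A) :
    M.inner (b + b') a = M.inner b a + M.inner b' a := by
  rw [M.inner_symm, M.inner_add, adj_add, ← M.inner_symm, ← M.inner_symm]

lemma smul_inner {A B : C} (c : ℂ) (b : M.Elem B) (a : M.Elem A) :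
    M.inner (c • b) a = star c • M.inner b a := by
  rw [M.inner_symm, M.inner_smul, adj_smul, ← M.inner_symm]

lemma act_inner {A B D : C} (b : M.Elem B) (a : M.Elem A) (f : Hom D B) :
    M.inner (M.act b f) a = adj f ⊚ M.inner b a := by
  rw [M.inner_symm, M.inner_act, adj_comp, ← M.inner_symm]

lemma inner_zero {A B : C} (b : M.Elem B) : M.inner b (0 : M.Elem A) = 0 := by
  simpa using M.inner_smul 0 b (0 : M.Elem A)

lemma zero_inner {A B : C} (a : M.Elem A) : M.inner (0 : M.Elem B) a = 0 := by
  simpa using M.smul_inner 0 (0 : M.Elem B) a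

lemma inner_sub {A B : C} (b : M.Elem B) (a a' : M.Elem A) :
    M.inner b (a - a') = M.inner b a - M.inner b a' := by
  have := M.inner_smul (-1) b a'
  rw [sub_eq_add_neg, M.inner_add]
  simp at this
  rw [this, sub_eq_add_neg]

lemma sub_inner {A B : C} (b b' : M.Elem B) (a : M.Elem A) :
    M.inner (b - b') a = M.inner b a - M.inner b' a := by
  rw [M.inner_symm, M.inner_sub, adj_sub, ← M.inner_symm, ← M.inner_symm]

lemma norm_inner_le_end {B : C} (b a : M.Elem B) : ‖M.inner b a‖ ≤ ‖b‖ * ‖a‖ := by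
  by_cases hb : b = 0
  · simp [hb, zero_inner]
  have hb' : 0 < ‖b‖ := norm_pos_iff.mpr hb
  set c := M.inner b a with hc
  set p := M.inner b b with hp
  have hpn : ‖p‖ = ‖b‖ ^ 2 := (M.norm_sq b).symm
  have hcs : M.inner a b = adj c := M.inner_symm _ _
  have h := norm_adj_conj_le p (M.inner_self_pos b) c ((‖p‖ ^ 2 : ℝ) • M.inner a a) ?_ ?_
  · rw [norm_smul, hpn, ← M.norm_sq] at h
    simp only [norm_pow, norm_norm] at h
    have : ‖c‖ ^ 2 ≤ (‖b‖ * ‖a‖) ^ 2 := by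
      have h2 : 0 < ‖b‖ ^ 2 := by positivity
      nlinarith
    exact (pow_le_pow_iff_left₀ (norm_nonneg _) (by positivity) two_ne_zero).mp this
  · have := M.inner_self_pos ((‖p‖ : ℂ) • a)
    rw [M.inner_smul, M.smul_inner, smul_smul] at this
    convert this using 1
    rw [← Complex.coe_smul]
    congr 1
    simp [sq]
  · have := M.inner_self_pos (M.act b c - (‖p‖ : ℂ) • a)
    convert this using 1
    rw [M.inner_sub, M.sub_inner, M.sub_inner, M.inner_smul, M.inner_smul, M.smul_inner,
      M.inner_act, M.inner_act, M.act_inner, M.act_inner, M.smul_inner, ← hc, hcs, ← hp,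
      comp_assoc]
    have e1 : star (‖p‖ : ℂ) = (‖p‖ : ℂ) := by simp
    rw [e1, ← Complex.coe_smul, ← Complex.coe_smul]
    push_cast
    module

/-- The Cauchy-Schwarz inequality. -/
lemma norm_inner_le {A B : C} (b : M.Elem B) (a : M.Elem A) : ‖M.inner b a‖ ≤ ‖b‖ * ‖a‖ := by
  set d := M.inner b a with hd
  have h := M.norm_inner_le_end b (M.act a (adj d))
  have h1 : ‖d ⊚ adj d‖ = ‖d‖ ^ 2 := by
    have := norm_adj_comp_self (adj d)
    rwa [adj_adj, norm_adj] at this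
  rw [M.inner_act, ← hd, h1] at h
  have h2 : ‖M.act a (adj d)‖ ^ 2 ≤ (‖a‖ * ‖d‖) ^ 2 := by
    rw [M.norm_sq, M.inner_act, M.act_inner, adj_adj]
    calc _ ≤ ‖d ⊚ M.inner a a‖ * ‖adj d‖ := norm_comp_le _ _
      _ ≤ ‖d‖ * ‖M.inner a a‖ * ‖adj d‖ := by gcongr; exact norm_comp_le _ _
      _ = _ := by rw [norm_adj, ← M.norm_sq]; ring
  have h3 : ‖M.act a (adj d)‖ ≤ ‖a‖ * ‖d‖ :=
    (pow_le_pow_iff_left₀ (norm_nonneg _) (by positivity) two_ne_zero).mp h2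
  by_cases h0 : ‖d‖ = 0
  · rw [h0]; positivity
  have : 0 < ‖d‖ := lt_of_le_of_ne (norm_nonneg _) (Ne.symm h0)
  have h4 : ‖d‖ * ‖d‖ ≤ (‖b‖ * ‖a‖) * ‖d‖ := by
    calc _ = ‖d‖ ^ 2 := (sq _).symm
      _ ≤ ‖b‖ * ‖M.act a (adj d)‖ := h
      _ ≤ ‖b‖ * (‖a‖ * ‖d‖) := by gcongr
      _ = _ := by ring
  exact le_of_mul_le_mul_right h4 this

lemma norm_act_le {A B : C} (a : M.Elem A) (f : Hom B A) : ‖M.act a f‖ ≤ ‖a‖ * ‖f‖ := by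
  have h2 : ‖M.act a f‖ ^ 2 ≤ (‖a‖ * ‖f‖) ^ 2 := by
    rw [M.norm_sq, M.inner_act, M.act_inner]
    calc _ ≤ ‖adj f ⊚ M.inner a a‖ * ‖f‖ := norm_comp_le _ _
      _ ≤ ‖adj f‖ * ‖M.inner a a‖ * ‖f‖ := by gcongr; exact norm_comp_le _ _
      _ = _ := by rw [norm_adj, ← M.norm_sq]; ring
  exact (pow_le_pow_iff_left₀ (norm_nonneg _) (by positivity) two_ne_zero).mp h2

/-- An element whose scalar products with itself vanish is zero. -/
lemma eq_zero_of_inner_self {A : C} {a : M.Elem A} (h : M.inner a a = 0) : a = 0 := by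
  have := M.norm_sq a
  rw [h, norm_zero] at this
  simpa using this

/-- The linear map `⟨b, -⟩`, as a continuous map. -/
def innerCLM {B : C} (b : M.Elem B) (A : C) : M.Elem A →L[ℂ] Hom A B :=
  LinearMap.mkContinuous
    { toFun := fun a => M.inner b a
      map_add' := fun a a' => M.inner_add b a a'
      map_smul' := fun c a => M.inner_smul c b a } ‖b‖ (fun a => M.norm_inner_le b a)

/-- The action of a morphism, as a continuous linear map. -/
def actCLM {A B : C} (f : Hom B A) : M.Elem A →L[ℂ] M.Elem B :=
  LinearMap.mkContinuous
    { toFun := fun a => M.act a f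
      map_add' := fun a a' => M.add_act a a' f
      map_smul' := fun c a => M.smul_act c a f } ‖f‖
    (fun a => by rw [mul_comm]; exact M.norm_act_le a f)

end HilbertModule

namespace CStarCategory

variable {C : Type u} [CStarCategory.{u, v} C]

section bounded

variable {M N P : HilbertModule C}

lemma app_add (f : BoundedMap M N) {A : C} (a b : M.Elem A) :
    app f (a + b) = app f a + app f b := map_add (f.1 A) a b

lemma app_smul (f : BoundedMap M N) (c : ℂ) {A : C} (a : M.Elem A) :
    app f (c • a) = c • app f a := map_smul (f.1 A) c a

lemma app_act (f : BoundedMap M N) {A B : C} (a : M.Elem A) (g : Hom B A) :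
    app f (M.act a g) = N.act (app f a) g := f.2 A B a g

lemma add_app (f g : BoundedMap M N) {A : C} (a : M.Elem A) :
    app (f + g) a = app f a + app g a := rfl

lemma smul_app (c : ℂ) (f : BoundedMap M N) {A : C} (a : M.Elem A) :
    app (c • f) a = c • app f a := rfl

lemma sub_app (f g : BoundedMap M N) {A : C} (a : M.Elem A) :
    app (f - g) a = app f a - app g a := rfl

lemma zero_app {A : C} (a : M.Elem A) : app (0 : BoundedMap M N) a = 0 := rfl

lemma app_ext {f g : BoundedMap M N} (h : ∀ (A : C) (a : M.Elem A), app f a = app g a) :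
    f = g :=
  Subtype.ext (lp.ext (funext fun A => ContinuousLinearMap.ext (h A)))

lemma norm_app_le (f : BoundedMap M N) {A : C} (a : M.Elem A) : ‖app f a‖ ≤ ‖f‖ * ‖a‖ :=
  ((f.1 A).le_opNorm a).trans
    (mul_le_mul_of_nonneg_right (lp.norm_apply_le_norm ENNReal.top_ne_zero f.1 A) (norm_nonneg a))

lemma norm_le_of_app {f : BoundedMap M N} {K : ℝ} (hK : 0 ≤ K)
    (h : ∀ (A : C) (a : M.Elem A), ‖app f a‖ ≤ K * ‖a‖) : ‖f‖ ≤ K :=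
  lp.norm_le_of_forall_le hK fun A => ContinuousLinearMap.opNorm_le_bound _ hK (h A)

/-- Build a bounded linear map from functions on elements. -/
def mkBounded (f : ∀ A : C, M.Elem A → N.Elem A)
    (hadd : ∀ A a b, f A (a + b) = f A a + f A b)
    (hsmul : ∀ A (c : ℂ) a, f A (c • a) = c • f A a)
    (hact : ∀ A B (a : M.Elem A) (g : Hom B A), f B (M.act a g) = N.act (f A a) g)
    (K : ℝ) (hK : 0 ≤ K) (hf : ∀ A a, ‖f A a‖ ≤ K * ‖a‖) : BoundedMap M N :=
  ⟨⟨fun A => LinearMap.mkContinuous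
      { toFun := f A, map_add' := hadd A, map_smul' := hsmul A } K (hf A),
    memℓp_infty ⟨K, by
      rintro _ ⟨A, rfl⟩
      exact LinearMap.mkContinuous_norm_le _ hK _⟩⟩,
    hact⟩

/-- The composite of bounded linear maps. -/
def compBounded (g : BoundedMap N P) (f : BoundedMap M N) : BoundedMap M P :=
  mkBounded (fun _ a => app g (app f a))
    (fun A a b => by rw [app_add, app_add]) (fun A c a => by rw [app_smul, app_smul])
    (fun A B a h => by rw [app_act, app_act]) (‖g‖ * ‖f‖) (by positivity) (fun A a => by
      calc _ ≤ ‖g‖ * ‖app f a‖ := norm_app_le _ _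
        _ ≤ ‖g‖ * (‖f‖ * ‖a‖) := by gcongr; exact norm_app_le _ _
        _ = _ := by ring)

/-- The identity map. -/
def idBounded (M : HilbertModule C) : BoundedMap M M :=
  mkBounded (fun _ a => a) (fun _ _ _ => rfl) (fun _ _ _ => rfl) (fun _ _ _ _ => rfl) 1
    zero_le_one (fun _ a => by rw [one_mul])

lemma comp_app (g : BoundedMap N P) (f : BoundedMap M N) {A : C} (a : M.Elem A) :
    app (compBounded g f) a = app g (app f a) := rfl

lemma norm_compBounded_le (g : BoundedMap N P) (f : BoundedMap M N) :
    ‖compBounded g f‖ ≤ ‖g‖ * ‖f‖ :=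
  norm_le_of_app (by positivity) fun A a => by
    calc _ ≤ ‖g‖ * ‖app f a‖ := norm_app_le _ _
      _ ≤ ‖g‖ * (‖f‖ * ‖a‖) := by gcongr; exact norm_app_le _ _
      _ = _ := by ring

/-- Evaluation at an element, as a continuous linear map. -/
def evalCLM {A : C} (a : M.Elem A) : BoundedMap M N →L[ℂ] N.Elem A :=
  LinearMap.mkContinuous
    { toFun := fun f => app f a, map_add' := fun _ _ => rfl, map_smul' := fun _ _ => rfl } ‖a‖
    (fun f => by rw [mul_comm]; exact norm_app_le f a)

instance : CompleteSpace (BoundedMap M N) := by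
  refine IsClosed.completeSpace_coe (hs := ?_)
  rw [← isSeqClosed_iff_isClosed]
  intro x f hx hf A B a g
  have key : ∀ (A : C) (a : M.Elem A),
      Filter.Tendsto (fun n => x n A a) Filter.atTop (nhds (f A a)) := by
    intro A a
    have h1 : Filter.Tendsto (fun n => ‖x n - f‖ * ‖a‖) Filter.atTop (nhds 0) := by
      have := (tendsto_iff_norm_sub_tendsto_zero.mp hf).mul_const ‖a‖
      simpa using this
    rw [tendsto_iff_norm_sub_tendsto_zero]
    refine squeeze_zero (fun _ => norm_nonneg _) (fun n => ?_) h1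
    exact (((x n - f) A).le_opNorm a).trans
      (mul_le_mul_of_nonneg_right (lp.norm_apply_le_norm ENNReal.top_ne_zero _ A) (norm_nonneg a))
  refine tendsto_nhds_unique (key B (M.act a g)) ?_
  have h2 := ((N.actCLM g).continuous.tendsto (f A a)).comp (key A a)
  refine h2.congr fun n => ?_
  exact (hx n A B a g).symm

lemma IsAdjointPair.symm {f : BoundedMap M N} {g : BoundedMap N M} (h : IsAdjointPair f g) :
    IsAdjointPair g f := by
  intro A B k m
  rw [N.inner_symm, ← h B A m k, ← M.inner_symm]

lemma IsAdjointPair.norm_le {f : BoundedMap M N} {g : BoundedMap N M} (h : IsAdjointPair f g) :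
    ‖g‖ ≤ ‖f‖ := by
  refine norm_le_of_app (norm_nonneg _) fun A k => ?_
  have h1 : ‖app g k‖ ^ 2 ≤ ‖f‖ * ‖app g k‖ * ‖k‖ := by
    rw [M.norm_sq, h]
    exact (N.norm_inner_le _ _).trans
      (mul_le_mul_of_nonneg_right (norm_app_le _ _) (norm_nonneg _))
  by_cases h0 : ‖app g k‖ = 0
  · rw [h0]; positivity
  have : 0 < ‖app g k‖ := lt_of_le_of_ne (norm_nonneg _) (Ne.symm h0)
  nlinarith

lemma IsAdjointPair.norm_eq {f : BoundedMap M N} {g : BoundedMap N M} (h : IsAdjointPair f g) :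
    ‖g‖ = ‖f‖ := le_antisymm h.norm_le h.symm.norm_le

lemma IsAdjointPair.add {f f' : BoundedMap M N} {g g' : BoundedMap N M}
    (h : IsAdjointPair f g) (h' : IsAdjointPair f' g') : IsAdjointPair (f + f') (g + g') := by
  intro A B a b
  rw [add_app, add_app, M.inner_add, N.add_inner, h, h']

lemma IsAdjointPair.smul {f : BoundedMap M N} {g : BoundedMap N M} (c : ℂ)
    (h : IsAdjointPair f g) : IsAdjointPair (c • f) (star c • g) := by
  intro A B a b
  rw [smul_app, smul_app, M.inner_smul, N.smul_inner, h]

lemma IsAdjointPair.sub {f f' : BoundedMap M N} {g g' : BoundedMap N M}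
    (h : IsAdjointPair f g) (h' : IsAdjointPair f' g') : IsAdjointPair (f - f') (g - g') := by
  intro A B a b
  rw [sub_app, sub_app, M.inner_sub, N.sub_inner, h, h']

lemma IsAdjointPair.zero : IsAdjointPair (0 : BoundedMap M N) 0 := by
  intro A B a b
  rw [zero_app, zero_app, M.inner_zero, N.zero_inner]

lemma IsAdjointPair.comp {f : BoundedMap M N} {g : BoundedMap N M} {f' : BoundedMap N P}
    {g' : BoundedMap P N} (h : IsAdjointPair f g) (h' : IsAdjointPair f' g') :
    IsAdjointPair (compBounded f' f) (compBounded g g') := by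
  intro A B a b
  rw [comp_app, comp_app, h, h']

lemma IsAdjointPair.id : IsAdjointPair (idBounded M) (idBounded M) := fun _ _ _ _ => rfl

lemma isClosed_adjointable :
    IsClosed {f : BoundedMap M N | ∃ g : BoundedMap N M, IsAdjointPair f g} := by
  rw [← isSeqClosed_iff_isClosed]
  intro x f hx hf
  choose y hy using hx
  have hc : CauchySeq y := by
    rw [Metric.cauchySeq_iff']
    intro ε hε
    obtain ⟨n, hn⟩ := Metric.cauchySeq_iff'.mp hf.cauchySeq ε hε
    refine ⟨n, fun m hm => ?_⟩
    rw [dist_eq_norm, ((hy m).sub (hy n)).norm_eq, ← dist_eq_norm]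
    exact hn m hm
  obtain ⟨g, hg⟩ := cauchySeq_tendsto_of_complete hc
  refine ⟨g, fun A B a b => ?_⟩
  have h1 : Filter.Tendsto (fun n => M.inner a (app (y n) b)) Filter.atTop
      (nhds (M.inner a (app g b))) :=
    ((M.innerCLM a B).continuous.tendsto _).comp (((evalCLM b).continuous.tendsto g).comp hg)
  have h2 : Filter.Tendsto (fun n => adj (N.inner b (app (x n) a))) Filter.atTop
      (nhds (adj (N.inner b (app f a)))) := by
    have h3 : Filter.Tendsto (fun n => N.inner b (app (x n) a)) Filter.atTop
        (nhds (N.inner b (app f a))) :=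
      ((N.innerCLM b A).continuous.tendsto _).comp (((evalCLM a).continuous.tendsto f).comp hf)
    rw [tendsto_iff_norm_sub_tendsto_zero] at h3 ⊢
    refine h3.congr fun n => ?_
    rw [← adj_sub, norm_adj]
  rw [← N.inner_symm] at h2
  refine tendsto_nhds_unique h1 (h2.congr fun n => ?_)
  rw [← N.inner_symm, hy n]

lemma IsAdjointPair.norm_comp_self {f : BoundedMap M N} {g : BoundedMap N M}
    (h : IsAdjointPair f g) : ‖compBounded g f‖ = ‖f‖ ^ 2 := by
  refine le_antisymm ?_ ?_
  · calc _ ≤ ‖g‖ * ‖f‖ := norm_compBounded_le _ _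
      _ = _ := by rw [h.norm_eq, sq]
  · have h1 : ‖f‖ ≤ √‖compBounded g f‖ := by
      refine norm_le_of_app (Real.sqrt_nonneg _) fun A a => ?_
      rw [← pow_le_pow_iff_left₀ (norm_nonneg _) (by positivity) two_ne_zero, mul_pow,
        Real.sq_sqrt (norm_nonneg _), N.norm_sq, ← h, ← comp_app]
      calc _ ≤ ‖a‖ * ‖app (compBounded g f) a‖ := M.norm_inner_le _ _
        _ ≤ ‖a‖ * (‖compBounded g f‖ * ‖a‖) := by gcongr; exact norm_app_le _ _
        _ = _ := by ring
    calc _ ≤ (√‖compBounded g f‖) ^ 2 := by gcongr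
      _ = _ := Real.sq_sqrt (norm_nonneg _)

end bounded

end CStarCategory

namespace SmallHilbertModule

open CStarCategory

variable {C : Type u} [CStarCategory.{u, v} C]

/-- The set of operators `f : X → Y`, each of which is encoded by its matrix
`l y x = ⟨gen y, f (gen x)⟩` with respect to the generators; so that it lies in `Type v`. -/
def opSubmodule (X Y : SmallHilbertModule C) :
    Submodule ℂ (∀ (y : Y.Gen) (x : X.Gen), Hom (X.src x) (Y.src y)) where
  carrier := {l | ∃ (f : BoundedMap X.toHilbertModule Y.toHilbertModule)
    (g : BoundedMap Y.toHilbertModule X.toHilbertModule),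
    IsAdjointPair f g ∧ ∀ y x, l y x = Y.inner (Y.gen y) (app f (X.gen x))}
  add_mem' := by
    rintro l l' ⟨f, g, h, hl⟩ ⟨f', g', h', hl'⟩
    refine ⟨f + f', g + g', h.add h', fun y x => ?_⟩
    rw [Pi.add_apply, Pi.add_apply, hl, hl', add_app, Y.inner_add]
  zero_mem' := ⟨0, 0, IsAdjointPair.zero, fun y x => by rw [zero_app, Y.inner_zero]; rfl⟩
  smul_mem' := by
    rintro c l ⟨f, g, h, hl⟩
    refine ⟨c • f, star c • g, h.smul c, fun y x => ?_⟩
    rw [Pi.smul_apply, Pi.smul_apply, hl, smul_app, Y.inner_smul]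

/-- The type of operators between small Hilbert modules. -/
def Op (X Y : SmallHilbertModule C) : Type v := ↥(opSubmodule X Y)

namespace Op

variable {X Y Z : SmallHilbertModule C}

/-- The underlying additive group. -/
abbrev addCommGroup (X Y : SmallHilbertModule C) : AddCommGroup (Op X Y) :=
  inferInstanceAs (AddCommGroup (opSubmodule X Y))

/-- The underlying vector space. -/
abbrev module (X Y : SmallHilbertModule C) : @Module ℂ (Op X Y) _ (addCommGroup X Y).toAddCommMonoid :=
  inferInstanceAs (Module ℂ (opSubmodule X Y))

/-- The bounded linear map underlying an operator. -/
def map (l : Op X Y) : BoundedMap X.toHilbertModule Y.toHilbertModule := l.2.choose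

/-- The adjoint of an operator, as a bounded linear map. -/
def adjMap (l : Op X Y) : BoundedMap Y.toHilbertModule X.toHilbertModule := l.2.choose_spec.choose

lemma isAdjointPair (l : Op X Y) : IsAdjointPair l.map l.adjMap :=
  l.2.choose_spec.choose_spec.1

lemma matrix_eq (l : Op X Y) (y : Y.Gen) (x : X.Gen) :
    l.1 y x = Y.inner (Y.gen y) (app l.map (X.gen x)) := l.2.choose_spec.choose_spec.2 y x

/-- The operator given by an adjoint pair of bounded linear maps. -/
def mk (f : BoundedMap X.toHilbertModule Y.toHilbertModule)
    (g : BoundedMap Y.toHilbertModule X.toHilbertModule) (h : IsAdjointPair f g) : Op X Y :=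
  ⟨fun y x => Y.inner (Y.gen y) (app f (X.gen x)), f, g, h, fun _ _ => rfl⟩

/-- Two continuous linear maps which agree on the generators are equal. -/
lemma clm_eq {A : C} {E : Type*} [AddCommGroup E] [Module ℂ E] [TopologicalSpace E] [T2Space E]
    (F G : X.Elem A →L[ℂ] E)
    (h : ∀ (x : X.Gen) (f : Hom A (X.src x)), F (X.act (X.gen x) f) = G (X.act (X.gen x) f)) :
    F = G := by
  refine ContinuousLinearMap.ext_on (s := {a | ∃ x f, a = X.act (X.gen x) f}) ?_ ?_
  · have := X.dense A
    rw [Submodule.dense_iff_topologicalClosure_eq_top]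
    exact this
  · rintro _ ⟨x, f, rfl⟩
    exact h x f

lemma map_unique {f f' : BoundedMap X.toHilbertModule Y.toHilbertModule}
    (h : ∀ y x, Y.inner (Y.gen y) (app f (X.gen x)) = Y.inner (Y.gen y) (app f' (X.gen x))) :
    f = f' := by
  have h1 : ∀ (x : X.Gen) (B : C) (b : Y.Elem B),
      Y.inner (app f (X.gen x)) b = Y.inner (app f' (X.gen x)) b := by
    intro x B b
    refine DFunLike.congr_fun (clm_eq (Y.innerCLM (app f (X.gen x)) B)
      (Y.innerCLM (app f' (X.gen x)) B) ?_) b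
    intro y g
    change Y.inner _ (Y.act _ _) = Y.inner _ (Y.act _ _)
    rw [Y.inner_act, Y.inner_act, Y.inner_symm, h, ← Y.inner_symm]
  have h2 : ∀ x, app f (X.gen x) = app f' (X.gen x) := by
    intro x
    rw [← sub_eq_zero]
    refine Y.eq_zero_of_inner_self ?_
    rw [Y.sub_inner, h1, sub_self]
  refine app_ext fun A a => ?_
  refine DFunLike.congr_fun (clm_eq (f.1 A) (f'.1 A) ?_) a
  intro x g
  change app f _ = app f' _
  rw [app_act, app_act, h2]

lemma map_mk (f : BoundedMap X.toHilbertModule Y.toHilbertModule)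
    (g : BoundedMap Y.toHilbertModule X.toHilbertModule) (h : IsAdjointPair f g) :
    (mk f g h).map = f :=
  map_unique fun y x => ((mk f g h).matrix_eq y x).symm

lemma ext_map {l l' : Op X Y} (h : l.map = l'.map) : l = l' := by
  refine Subtype.ext (funext fun y => funext fun x => ?_)
  rw [matrix_eq, matrix_eq, h]

section

attribute [local instance] addCommGroup module

/-- Passing from an operator to the underlying bounded map is linear. -/
def mapLinear (X Y : SmallHilbertModule C) :
    Op X Y →ₗ[ℂ] BoundedMap X.toHilbertModule Y.toHilbertModule where
  toFun := map
  map_add' l l' := by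
    refine map_unique fun y x => ?_
    rw [← matrix_eq, add_app, Y.inner_add, ← matrix_eq, ← matrix_eq]
    rfl
  map_smul' c l := by
    refine map_unique fun y x => ?_
    rw [RingHom.id_apply, ← matrix_eq, smul_app, Y.inner_smul, ← matrix_eq]
    rfl

/-- The norm of an operator is the norm `sup_A ‖f_A‖` of the underlying bounded linear map. -/
instance normedAddCommGroup : NormedAddCommGroup (Op X Y) :=
  NormedAddCommGroup.induced (Op X Y) (BoundedMap X.toHilbertModule Y.toHilbertModule)
    (mapLinear X Y) (fun _ _ h => ext_map h)

instance normedSpace : NormedSpace ℂ (Op X Y) :=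
  NormedSpace.induced ℂ (Op X Y) (BoundedMap X.toHilbertModule Y.toHilbertModule) (mapLinear X Y)

end

lemma map_add (l l' : Op X Y) : (l + l').map = l.map + l'.map :=
  (mapLinear X Y).map_add' l l'

lemma map_smul (c : ℂ) (l : Op X Y) : (c • l).map = c • l.map :=
  (mapLinear X Y).map_smul' c l

lemma norm_eq (l : Op X Y) : ‖l‖ = ‖l.map‖ := rfl

instance : CompleteSpace (Op X Y) := by
  have hi : Isometry (mapLinear X Y) := fun _ _ => rfl
  rw [completeSpace_iff_isComplete_range hi.isUniformInducing]
  refine IsClosed.isComplete ?_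
  have hr : Set.range (mapLinear X Y) = {f : BoundedMap X.toHilbertModule Y.toHilbertModule |
      ∃ g : BoundedMap Y.toHilbertModule X.toHilbertModule, IsAdjointPair f g} := by
    ext f
    constructor
    · rintro ⟨l, rfl⟩
      exact ⟨_, l.isAdjointPair⟩
    · rintro ⟨g, h⟩
      exact ⟨mk f g h, map_mk f g h⟩
  rw [hr]
  exact isClosed_adjointable

/-- Composition of operators. -/
def comp (l : Op Y Z) (k : Op X Y) : Op X Z :=
  mk (compBounded l.map k.map) (compBounded k.adjMap l.adjMap) (k.isAdjointPair.comp l.isAdjointPair)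

/-- The adjoint of an operator. -/
def adj (l : Op X Y) : Op Y X := mk l.adjMap l.map l.isAdjointPair.symm

lemma map_comp (l : Op Y Z) (k : Op X Y) : (comp l k).map = compBounded l.map k.map := map_mk _ _ _

lemma map_adj (l : Op X Y) : (adj l).map = l.adjMap := map_mk _ _ _

lemma adj_unique {f : BoundedMap X.toHilbertModule Y.toHilbertModule}
    {g g' : BoundedMap Y.toHilbertModule X.toHilbertModule}
    (h : IsAdjointPair f g) (h' : IsAdjointPair f g') : g = g' :=
  map_unique fun y x => by rw [h, h']

lemma ext_adj {l l' : Op X Y} (h : l.map = l'.map) : l.adjMap = l'.adjMap :=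
  adj_unique l.isAdjointPair (h ▸ l'.isAdjointPair)

lemma adjMap_eq {l : Op X Y} {g : BoundedMap Y.toHilbertModule X.toHilbertModule}
    (h : IsAdjointPair l.map g) : l.adjMap = g := adj_unique l.isAdjointPair h

lemma comp_add (g : Op Y Z) (f f' : Op X Y) : comp g (f + f') = comp g f + comp g f' :=
  ext_map (by
    simp only [map_comp, map_add]
    exact app_ext fun A a => by simp only [comp_app, add_app, app_add])

lemma add_comp (g g' : Op Y Z) (f : Op X Y) : comp (g + g') f = comp g f + comp g' f :=
  ext_map (by
    simp only [map_comp, map_add]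
    exact app_ext fun A a => by simp only [comp_app, add_app])

lemma comp_smul (c : ℂ) (g : Op Y Z) (f : Op X Y) : comp g (c • f) = c • comp g f :=
  ext_map (by
    simp only [map_comp, map_smul]
    exact app_ext fun A a => by simp only [comp_app, smul_app, app_smul])

lemma smul_comp (c : ℂ) (g : Op Y Z) (f : Op X Y) : comp (c • g) f = c • comp g f :=
  ext_map (by
    simp only [map_comp, map_smul]
    exact app_ext fun A a => by simp only [comp_app, smul_app])

lemma comp_assoc {W : SmallHilbertModule C} (h : Op Z W) (g : Op Y Z) (f : Op X Y) :
    comp (comp h g) f = comp h (comp g f) :=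
  ext_map (by
    simp only [map_comp]
    exact app_ext fun A a => by simp only [comp_app])

lemma norm_comp_le (g : Op Y Z) (f : Op X Y) : ‖comp g f‖ ≤ ‖g‖ * ‖f‖ := by
  rw [norm_eq, norm_eq, norm_eq, map_comp]
  exact norm_compBounded_le _ _

lemma adj_adj (f : Op X Y) : adj (adj f) = f :=
  ext_map (by
    rw [map_adj]
    exact adjMap_eq (by rw [map_adj]; exact f.isAdjointPair.symm))

lemma adj_comp (g : Op Y Z) (f : Op X Y) : adj (comp g f) = comp (adj f) (adj g) :=
  ext_map (by
    rw [map_adj, map_comp, map_adj, map_adj]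
    exact adjMap_eq (by rw [map_comp]; exact f.isAdjointPair.comp g.isAdjointPair))

lemma adj_add (f g : Op X Y) : adj (f + g) = adj f + adj g :=
  ext_map (by
    rw [map_adj, map_add, map_adj, map_adj]
    exact adjMap_eq (by rw [map_add]; exact f.isAdjointPair.add g.isAdjointPair))

lemma adj_smul (c : ℂ) (f : Op X Y) : adj (c • f) = star c • adj f :=
  ext_map (by
    rw [map_adj, map_smul, map_adj]
    exact adjMap_eq (by rw [map_smul]; exact f.isAdjointPair.smul c))

lemma norm_adj (f : Op X Y) : ‖adj f‖ = ‖f‖ := by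
  rw [norm_eq, norm_eq, map_adj]
  exact f.isAdjointPair.norm_eq

end Op

/-- Small Hilbert modules and operators form a Banach `*`-category. -/
instance instBanachStarCategory : BanachStarCategory.{max u (v + 1), v} (SmallHilbertModule C) where
  Hom := Op
  comp := Op.comp
  adj := Op.adj
  comp_assoc := Op.comp_assoc
  comp_add := Op.comp_add
  add_comp := Op.add_comp
  comp_smul := Op.comp_smul
  smul_comp := Op.smul_comp
  norm_comp_le := Op.norm_comp_le
  adj_adj := Op.adj_adj
  adj_comp := Op.adj_comp
  adj_add := Op.adj_add
  adj_smul := Op.adj_smul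
  norm_adj := Op.norm_adj

lemma norm_adj_comp_self {X Y : SmallHilbertModule C} (f : Hom X Y) :
    ‖BanachStarCategory.adj f ⊚ f‖ = ‖f‖ ^ 2 := by
  change ‖(Op.comp (Op.adj f) f).map‖ = ‖Op.map f‖ ^ 2
  rw [Op.map_comp, Op.map_adj]
  exact (Op.isAdjointPair f).norm_comp_self

end SmallHilbertModule

namespace SmallHilbertModule

open CStarCategory

variable {C : Type u} [CStarCategory.{u, v} C]

/-- The value of an operator on an element. -/
def opApp {X Y : SmallHilbertModule C} (f : Hom X Y) {A : C} (a : X.Elem A) : Y.Elem A :=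
  app (Op.map f) a

lemma opApp_comp {X Y Z : SmallHilbertModule C} (g : Hom Y Z) (f : Hom X Y) {A : C}
    (a : X.Elem A) : opApp (g ⊚ f) a = opApp g (opApp f a) := by
  change app (Op.map (Op.comp g f)) a = _
  rw [Op.map_comp, comp_app]
  rfl

lemma opApp_neg {X Y : SmallHilbertModule C} (f : Hom X Y) {A : C}
    (a : X.Elem A) : opApp (-f) a = (-1 : ℂ) • opApp f a := by
  rw [← neg_one_smul ℂ f]
  change app (Op.map ((-1 : ℂ) • f : Op X Y)) a = _
  rw [Op.map_smul, smul_app]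
  rfl

lemma opApp_ext {X Y : SmallHilbertModule C} {f g : Hom X Y}
    (h : ∀ (A : C) (a : X.Elem A), opApp f a = opApp g a) : f = g :=
  Op.ext_map (app_ext h)

lemma inner_opApp {X Y : SmallHilbertModule C} (f : Hom X Y) {A B : C} (b : X.Elem B)
    (a : Y.Elem A) : X.inner b (opApp (BanachStarCategory.adj f) a) = Y.inner (opApp f b) a := by
  change X.inner b (app (Op.map (Op.adj f)) a) = _
  rw [Op.map_adj]
  exact Op.isAdjointPair f B A b a

lemma eq_zero_of_pos_of_neg_pos {A : C} {p : Hom A A} (h : IsPositiveEnd p)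
    (h' : IsPositiveEnd (-p)) : p = 0 := by
  let _ := endAlgebra A CStarCategory.norm_adj_comp_self
  let _ := CStarAlgebra.spectralOrder (Hom A A)
  let _ := CStarAlgebra.spectralOrderedRing (Hom A A)
  obtain ⟨b, hb⟩ := h
  obtain ⟨b', hb'⟩ := h'
  have h1 : 0 ≤ p := by rw [hb]; exact star_mul_self_nonneg b
  have h2 : 0 ≤ -p := by rw [hb']; exact star_mul_self_nonneg b'
  exact le_antisymm (neg_nonneg.mp h2) h1

lemma exists_sqrt {X Y : SmallHilbertModule C} (f : Hom X Y) :
    ∃ b : Hom X X, BanachStarCategory.adj f ⊚ f = BanachStarCategory.adj b ⊚ b := by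
  let _ := endAlgebra X norm_adj_comp_self
  let _ := CStarAlgebra.spectralOrder (Hom X X)
  let _ := CStarAlgebra.spectralOrderedRing (Hom X X)
  set F : Hom X X := BanachStarCategory.adj f ⊚ f with hF
  have hsa : IsSelfAdjoint F := by
    change BanachStarCategory.adj F = F
    rw [hF, BanachStarCategory.adj_comp, BanachStarCategory.adj_adj]
  have hS : 0 ≤ F⁻ := CFC.negPart_nonneg F
  have hSs : star F⁻ = F⁻ := hS.isSelfAdjoint
  have hmul : F * F⁻ = -(F⁻ * F⁻) := by
    have h1 := CFC.posPart_sub_negPart F hsa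
    have h2 := CFC.posPart_mul_negPart F
    calc F * F⁻ = (F⁺ - F⁻) * F⁻ := by rw [h1]
      _ = _ := by rw [sub_mul, h2, zero_sub]
  obtain ⟨T, hT⟩ := CStarAlgebra.nonneg_iff_eq_star_mul_self.mp (star_left_conjugate_nonneg hS F⁻)
  have key : BanachStarCategory.adj (f ⊚ F⁻) ⊚ (f ⊚ F⁻) = -(BanachStarCategory.adj T ⊚ T) := by
    rw [BanachStarCategory.adj_comp, BanachStarCategory.comp_assoc,
      ← BanachStarCategory.comp_assoc _ f]
    change star F⁻ * (F * F⁻) = -(star T * T)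
    rw [hmul, ← hT, mul_neg, mul_assoc]
  have hT0 : T = 0 := by
    refine opApp_ext fun A a => ?_
    have e : -(X.inner (opApp T a) (opApp T a)) =
        Y.inner (opApp (f ⊚ F⁻) a) (opApp (f ⊚ F⁻) a) := by
      rw [← inner_opApp, ← inner_opApp, ← opApp_comp, ← opApp_comp, key, opApp_neg, X.inner_smul,
        neg_one_smul]
    have h0 : X.inner (opApp T a) (opApp T a) = 0 :=
      eq_zero_of_pos_of_neg_pos (X.inner_self_pos _) (e ▸ Y.inner_self_pos _)
    rw [X.eq_zero_of_inner_self h0]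
    have : opApp (0 : Hom X X) a = 0 := by
      have := opApp_neg (0 : Hom X X) a
      rw [neg_zero] at this
      have h2 : (2 : ℂ) • opApp (0 : Hom X X) a = 0 := by
        calc (2 : ℂ) • opApp (0 : Hom X X) a
            = opApp (0 : Hom X X) a + opApp (0 : Hom X X) a := two_smul _ _
          _ = (-1 : ℂ) • opApp (0 : Hom X X) a + opApp (0 : Hom X X) a := by rw [← this]
          _ = 0 := by rw [neg_one_smul]; exact neg_add_cancel _
      exact (smul_eq_zero.mp h2).resolve_left two_ne_zero
    exact this.symm
  have hS3 : star F⁻ * F⁻ * F⁻ = 0 := by rw [hT, hT0, mul_zero]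
  have hS0 : F⁻ = 0 := by
    have h4 : star (F⁻ * F⁻) * (F⁻ * F⁻) = 0 := by
      rw [star_mul, hSs, mul_assoc, ← mul_assoc F⁻ F⁻ F⁻]
      nth_rewrite 2 [← hSs]
      rw [hS3, mul_zero]
    have h5 : star F⁻ * F⁻ = 0 := by
      rw [hSs]
      exact CStarRing.star_mul_self_eq_zero_iff _ |>.mp h4
    exact CStarRing.star_mul_self_eq_zero_iff _ |>.mp h5
  have hF0 : 0 ≤ F := (CFC.negPart_eq_zero_iff F hsa).mp hS0
  exact CStarAlgebra.nonneg_iff_eq_star_mul_self.mp hF0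

/-- The `C^*`-category `ℋ C` of small Hilbert `C`-modules and operators; it is unital. -/
instance instUnitalCStarCategory :
    UnitalCStarCategory.{max u (v + 1), v} (SmallHilbertModule C) where
  norm_adj_comp_self := norm_adj_comp_self
  adj_comp_self_pos := exists_sqrt
  one X := Op.mk (idBounded X.toHilbertModule) (idBounded X.toHilbertModule) IsAdjointPair.id
  one_comp f := opApp_ext fun A a => by
    change app (Op.map (Op.comp _ _)) a = _
    rw [Op.map_comp, Op.map_mk]
    rfl
  comp_one f := opApp_ext fun A a => by
    change app (Op.map (Op.comp _ _)) a = _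
    rw [Op.map_comp, Op.map_mk]
    rfl

end SmallHilbertModule

namespace CStarCategory

variable {C : Type u} [CStarCategory.{u, v} C]

/-- The Hilbert module `X ↦ Hom X A` with `⟨u, v⟩ = u^* v`. -/
def yonedaModule (A : C) : HilbertModule C where
  Elem X := Hom X A
  act a f := a ⊚ f
  inner b a := adj b ⊚ a
  act_add a f g := comp_add a f g
  add_act a b f := add_comp a b f
  act_smul c a f := comp_smul c a f
  smul_act c a f := smul_comp c a f
  act_comp a f g := (comp_assoc a f g).symm
  inner_symm b a := by rw [adj_comp, adj_adj]
  inner_add b a a' := comp_add _ a a'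
  inner_smul c b a := comp_smul c _ a
  inner_act b a f := (comp_assoc _ a f).symm
  inner_self_pos a := adj_comp_self_pos a
  norm_sq a := (norm_adj_comp_self a).symm

lemma mem_closure_end_comp {A B : C} (h : Hom B A) :
    h ∈ (Submodule.span ℂ
      {a : Hom B A | ∃ (x : Hom A A) (f : Hom B A), a = x ⊚ f}).topologicalClosure := by
  let _ := endAlgebra A norm_adj_comp_self
  let _ := CStarAlgebra.spectralOrder (Hom A A)
  let _ := CStarAlgebra.spectralOrderedRing (Hom A A)
  have hu := CStarAlgebra.increasingApproximateUnit (Hom A A)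
  have : (CStarAlgebra.approximateUnit (Hom A A)).NeBot := hu.neBot
  set x : Hom A A := h ⊚ adj h with hx
  have h1 : Filter.Tendsto (fun e : Hom A A => e * x) (CStarAlgebra.approximateUnit (Hom A A))
      (nhds x) := hu.tendsto_mul_right x
  have h2 : Filter.Tendsto (fun e : Hom A A => e ⊚ h) (CStarAlgebra.approximateUnit (Hom A A))
      (nhds h) := by
    rw [tendsto_iff_norm_sub_tendsto_zero] at h1 ⊢
    have h3 : Filter.Tendsto (fun e : Hom A A => √(‖e * x - x‖ * 2))
        (CStarAlgebra.approximateUnit (Hom A A)) (nhds 0) := by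
      have := (h1.mul_const 2).sqrt
      simpa using this
    refine squeeze_zero' (Filter.Eventually.of_forall fun _ => norm_nonneg _) ?_ h3
    filter_upwards [hu.eventually_norm] with e he
    refine Real.le_sqrt_of_sq_le ?_
    have e1 : ‖e ⊚ h - h‖ ^ 2 = ‖(e ⊚ h - h) ⊚ adj (e ⊚ h - h)‖ := by
      have := norm_adj_comp_self (adj (e ⊚ h - h))
      rw [adj_adj, norm_adj] at this
      exact this.symm
    have e2 : (e ⊚ h - h) ⊚ adj (e ⊚ h - h) = (e * x - x) * star e - (e * x - x) := by
      have s1 : ∀ (D E F : C) (p q : Hom E F) (r : Hom D E), (p - q) ⊚ r = p ⊚ r - q ⊚ r := by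
        intro D E F p q r
        rw [eq_sub_iff_add_eq, ← add_comp, sub_add_cancel]
      have s2 : ∀ (D E F : C) (p : Hom E F) (q r : Hom D E), p ⊚ (q - r) = p ⊚ q - p ⊚ r := by
        intro D E F p q r
        rw [eq_sub_iff_add_eq, ← comp_add, sub_add_cancel]
      rw [adj_sub, adj_comp, s2, s1, s1, ← comp_assoc (e ⊚ h), ← comp_assoc h, comp_assoc e,
        ← hx, sub_mul]
      change (e * x) * star e - x * star e - (e * x - x) = _
      rfl
    rw [e1, e2]
    calc _ ≤ ‖(e * x - x) * star e‖ + ‖e * x - x‖ := norm_sub_le _ _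
      _ ≤ ‖e * x - x‖ * ‖star e‖ + ‖e * x - x‖ := by gcongr; exact norm_mul_le _ _
      _ ≤ ‖e * x - x‖ * 1 + ‖e * x - x‖ := by
        gcongr
        exact (norm_adj e).le.trans he
      _ = _ := by ring
  refine mem_closure_of_tendsto h2 (Filter.Eventually.of_forall fun e => ?_)
  exact Submodule.subset_span ⟨e, h, rfl⟩

/-- The Yoneda embedding on objects: the small Hilbert module `𝕐 A`, generated by the endomorphisms
of `A`, seen as elements of `𝕐 A` over `A`. -/
def yoneda (A : C) : SmallHilbertModule C where
  toHilbertModule := yonedaModule A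
  Gen := Hom A A
  src _ := A
  gen x := x
  dense B := by
    rw [eq_top_iff]
    rintro h -
    exact mem_closure_end_comp h

/-- The operator `𝕐 A → H`, `f ↦ a ∘ f`, given by an element `a` of `H` over `A`. -/
def elemOp {H : SmallHilbertModule C} {A : C} (a : H.Elem A) : Hom (yoneda A) H :=
  SmallHilbertModule.Op.mk (X := yoneda A)
    (mkBounded (M := yonedaModule A) (fun _ f => H.act a f) (fun _ f g => H.act_add a f g)
      (fun _ c f => H.act_smul c a f) (fun _ _ f g => H.act_comp a f g) ‖a‖ (norm_nonneg a)
      (fun _ f => H.norm_act_le a f))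
    (mkBounded (N := yonedaModule A) (fun _ b => H.inner a b) (fun _ b b' => H.inner_add a b b')
      (fun _ c b => H.inner_smul c a b) (fun _ _ b g => H.inner_act a b g) ‖a‖ (norm_nonneg a)
      (fun _ b => H.norm_inner_le a b))
    (fun _ _ f b => (H.act_inner a b f).symm)

/-- The Yoneda embedding on morphisms: `𝕐 f` is composition with `f`. -/
def yonedaMap {A B : C} (f : Hom A B) : Hom (yoneda A) (yoneda B) :=
  elemOp (H := yoneda B) f

/-- An isometric isomorphism in a unital `C^*`-category. -/
def IsUnitary {D : Type u} [UnitalCStarCategory.{u, v} D] {A B : D} (f : Hom A B) : Prop :=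
  adj f ⊚ f = UnitalCStarCategory.one A ∧ f ⊚ adj f = UnitalCStarCategory.one B

end CStarCategory

/-- A `C^*`-functor: a `ℂ`-linear functor (not assumed to preserve units) which commutes with the
involution. -/
structure CStarFunctor (C : Type u) (D : Type w) [CStarCategory.{u, v} C] [CStarCategory.{w, v} D] where
  obj : C → D
  map : ∀ {A B : C}, Hom A B →ₗ[ℂ] Hom (obj A) (obj B)
  map_comp : ∀ {A B E : C} (g : Hom B E) (f : Hom A B), map (g ⊚ f) = map g ⊚ map f
  map_adj : ∀ {A B : C} (f : Hom A B), map (adj f) = adj (map f)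

/-- A realisation of the functor `ℋ f : ℋ C → ℋ D` induced by a `C^*`-functor `f : C → D`: it sends a
module `X` with generators `x` to a module with generators `elem X x` indexed by the same set, whose
matrix of scalar products is the image under `f` of the matrix of scalar products of the generators
of `X`, and it sends an operator with matrix `l` to the operator with matrix `f l`.
These requirements determine `ℋ f` up to a unique unitary isomorphism compatible with `elem`. -/
structure ModuleExtension {C : Type u} {D : Type w} [CStarCategory.{u, v} C] [CStarCategory.{w, v} D]
    (f : CStarFunctor C D) where
  functor : CStarFunctor (SmallHilbertModule C) (SmallHilbertModule D)
  elem : ∀ (X : SmallHilbertModule C) (x : X.Gen), (functor.obj X).Elem (f.obj (X.src x))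
  inner_elem : ∀ (X : SmallHilbertModule C) (x y : X.Gen),
    (functor.obj X).inner (elem X x) (elem X y) = f.map (X.inner (X.gen x) (X.gen y))
  dense : ∀ (X : SmallHilbertModule C) (A : D), (Submodule.span ℂ
    {a : (functor.obj X).Elem A | ∃ (x : X.Gen) (g : Hom A (f.obj (X.src x))),
      a = (functor.obj X).act (elem X x) g}).topologicalClosure = ⊤
  map_elem : ∀ {X Y : SmallHilbertModule C} (h : Hom X Y) (x : X.Gen) (y : Y.Gen),
    (functor.obj Y).inner (elem Y y) (SmallHilbertModule.opApp (functor.map h) (elem X x)) =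
      f.map (Y.inner (Y.gen y) (SmallHilbertModule.opApp h (X.gen x)))

/-- A pre-complete structure on a unital `C^*`-category `C`: a unital `C^*`-functor `L : ℋ C → C` with
a natural isometric isomorphism `Id ≃ L ∘ 𝕐`. -/
structure PreComplete (C : Type u) [UnitalCStarCategory.{u, v} C] where
  L : CStarFunctor (SmallHilbertModule C) C
  map_one : ∀ H : SmallHilbertModule C,
    L.map (UnitalCStarCategory.one H) = UnitalCStarCategory.one (L.obj H)
  unit : ∀ A : C, Hom A (L.obj (yoneda A))
  unit_isUnitary : ∀ A : C, IsUnitary (unit A)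
  unit_natural : ∀ {A B : C} (f : Hom A B), L.map (yonedaMap f) ⊚ unit A = unit B ⊚ f

/-- A hereditary sub-`C^*`-algebra of the algebra of endomorphisms of `X`. -/
structure HereditarySubalgebra {C : Type u} [CStarCategory.{u, v} C] (X : C) where
  carrier : Submodule ℂ (Hom X X)
  isClosed : IsClosed (carrier : Set (Hom X X))
  comp_mem : ∀ {a b : Hom X X}, a ∈ carrier → b ∈ carrier → a ⊚ b ∈ carrier
  adj_mem : ∀ {a : Hom X X}, a ∈ carrier → adj a ∈ carrier
  comp_comp_mem : ∀ {a b : Hom X X} (c : Hom X X), a ∈ carrier → b ∈ carrier →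
    a ⊚ c ⊚ b ∈ carrier

namespace HereditarySubalgebra

variable {C : Type u} [UnitalCStarCategory.{u, v} C] {X : C}

/-- The closed linear span of the morphisms `a ∘ h : Z → X` with `a ∈ 𝒜`. -/
def elems (𝒜 : HereditarySubalgebra X) (Z : C) : Submodule ℂ (Hom Z X) :=
  (Submodule.span ℂ {k : Hom Z X | ∃ a ∈ 𝒜.carrier, ∃ h : Hom Z X, k = a ⊚ h}).topologicalClosure

lemma elems_comp (𝒜 : HereditarySubalgebra X) {Z W : C} {k : Hom Z X} (hk : k ∈ 𝒜.elems Z)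
    (g : Hom W Z) : k ⊚ g ∈ 𝒜.elems W := by
  let F : Hom Z X →L[ℂ] Hom W X := (yonedaModule X).actCLM g
  have h1 : Submodule.span ℂ {k : Hom Z X | ∃ a ∈ 𝒜.carrier, ∃ h : Hom Z X, k = a ⊚ h} ≤
      (Submodule.span ℂ
        {k : Hom W X | ∃ a ∈ 𝒜.carrier, ∃ h : Hom W X, k = a ⊚ h}).comap F.toLinearMap := by
    rw [Submodule.span_le]
    rintro _ ⟨a, ha, h, rfl⟩
    exact Submodule.subset_span ⟨a, ha, h ⊚ g, comp_assoc a h g⟩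
  have h2 : Set.MapsTo F
      (↑(Submodule.span ℂ {k : Hom Z X | ∃ a ∈ 𝒜.carrier, ∃ h : Hom Z X, k = a ⊚ h}))
      (↑(Submodule.span ℂ {k : Hom W X | ∃ a ∈ 𝒜.carrier, ∃ h : Hom W X, k = a ⊚ h})) :=
    fun x hx => h1 hx
  exact h2.closure F.continuous hk

lemma mem_elems (𝒜 : HereditarySubalgebra X) {a : Hom X X} (ha : a ∈ 𝒜.carrier) {Z : C}
    (h : Hom Z X) : a ⊚ h ∈ 𝒜.elems Z :=
  Submodule.le_topologicalClosure _ (Submodule.subset_span ⟨a, ha, h, rfl⟩)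

/-- The small Hilbert module `𝒜 X`: the submodule of `𝕐 X` spanned by the image of the action of
`𝒜`, with the elements of `𝒜` as generators. -/
def module (𝒜 : HereditarySubalgebra X) : SmallHilbertModule C where
  Elem Z := 𝒜.elems Z
  completeSpace Z := (Submodule.isClosed_topologicalClosure _).completeSpace_coe
  act k f := ⟨k.1 ⊚ f, 𝒜.elems_comp k.2 f⟩
  inner b a := adj b.1 ⊚ a.1
  act_add a f g := Subtype.ext (comp_add a.1 f g)
  add_act a b f := Subtype.ext (add_comp a.1 b.1 f)
  act_smul c a f := Subtype.ext (comp_smul c a.1 f)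
  smul_act c a f := Subtype.ext (smul_comp c a.1 f)
  act_comp a f g := Subtype.ext (comp_assoc a.1 f g).symm
  inner_symm b a := by rw [adj_comp, adj_adj]
  inner_add b a a' := comp_add _ a.1 a'.1
  inner_smul c b a := comp_smul c _ a.1
  inner_act b a f := (comp_assoc _ a.1 f).symm
  inner_self_pos a := adj_comp_self_pos a.1
  norm_sq a := (norm_adj_comp_self a.1).symm
  Gen := 𝒜.carrier
  src _ := X
  gen a := ⟨a.1, by
    have := 𝒜.mem_elems a.2 (UnitalCStarCategory.one X)
    rwa [UnitalCStarCategory.comp_one] at this⟩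
  dense Z := by
    rw [← Submodule.dense_iff_topologicalClosure_eq_top]
    rintro ⟨k, hk⟩
    rw [Metric.mem_closure_iff]
    intro ε hε
    obtain ⟨b, hb, hd⟩ := Metric.mem_closure_iff.mp hk ε hε
    have key : ∀ b ∈ Submodule.span ℂ
        {k : Hom Z X | ∃ a ∈ 𝒜.carrier, ∃ h : Hom Z X, k = a ⊚ h},
        ∃ c : 𝒜.elems Z, c.1 = b ∧ c ∈ Submodule.span ℂ {c : 𝒜.elems Z |
          ∃ (a : 𝒜.carrier) (h : Hom Z X), c = ⟨a.1 ⊚ h, 𝒜.mem_elems a.2 h⟩} := by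
      intro b hb
      induction hb using Submodule.span_induction with
      | mem b hb =>
        obtain ⟨a, ha, h, rfl⟩ := hb
        exact ⟨⟨a ⊚ h, 𝒜.mem_elems ha h⟩, rfl, Submodule.subset_span ⟨⟨a, ha⟩, h, rfl⟩⟩
      | zero => exact ⟨0, rfl, Submodule.zero_mem _⟩
      | add b b' _ _ hb hb' =>
        obtain ⟨c, rfl, hc⟩ := hb
        obtain ⟨c', rfl, hc'⟩ := hb'
        exact ⟨c + c', rfl, Submodule.add_mem _ hc hc'⟩
      | smul r b _ hb =>
        obtain ⟨c, rfl, hc⟩ := hb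
        exact ⟨r • c, rfl, Submodule.smul_mem _ r hc⟩
    obtain ⟨c, rfl, hc⟩ := key b hb
    exact ⟨c, hc, hd⟩

end HereditarySubalgebra

namespace PreComplete

variable {C : Type u} [UnitalCStarCategory.{u, v} C] (P : PreComplete C)

/-- The isometric embedding `H → 𝕐 (L H)`: an element `a` of `H` over `A` is sent to the composite
`A ≃ L (𝕐 A) → L H`, whose second map is the image under `L` of the operator `𝕐 A → H` given by
`a`. -/
def embed {H : SmallHilbertModule C} {A : C} (a : H.Elem A) : Hom A (P.L.obj H) :=
  P.L.map (elemOp a) ⊚ P.unit A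

/-- A hereditary subalgebra `𝒜` of the endomorphisms of `X` is weakly dense if `L (𝒜 X)` is isomorphic
to `X`, by an isomorphism compatible with the embeddings of `𝒜 X` into `L (𝒜 X)` and into `X`. -/
def IsWeaklyDense {X : C} (𝒜 : HereditarySubalgebra X) : Prop :=
  ∃ u : Hom (P.L.obj 𝒜.module) X, IsUnitary u ∧
    ∀ (Z : C) (h : 𝒜.module.Elem Z), u ⊚ P.embed h = h.1

/-- The functor `f : C → D` between pre-complete categories is continuous: `L' ∘ ℋ f` and `f ∘ L` are
isomorphic by a natural unitary isomorphism, which on a representable module `𝕐 A` is the canonical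
isomorphism `f (L (𝕐 A)) ≃ f A ≃ L' (𝕐 (f A)) ≃ L' (ℋ f (𝕐 A))` coming from the unitality of `f`. -/
def IsContinuous {D : Type w} [UnitalCStarCategory.{w, v} D] (P : PreComplete C)
    (Q : PreComplete D) (f : CStarFunctor C D) : Prop :=
  (∀ A : C, f.map (UnitalCStarCategory.one A) = UnitalCStarCategory.one (f.obj A)) ∧
  ∃ (F : ModuleExtension f)
    (θ : ∀ X : SmallHilbertModule C, Hom (f.obj (P.L.obj X)) (Q.L.obj (F.functor.obj X))),
    (∀ X, IsUnitary (θ X)) ∧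
    (∀ (X Y : SmallHilbertModule C) (h : Hom X Y),
      Q.L.map (F.functor.map h) ⊚ θ X = θ Y ⊚ f.map (P.L.map h)) ∧
    ∀ A : C, θ (yoneda A) ⊚ f.map (P.unit A) =
      Q.embed (H := F.functor.obj (yoneda A)) (F.elem (yoneda A) (UnitalCStarCategory.one A))

/-- A pre-complete structure on `ℋ C` is the restriction structure if, up to a natural isomorphism `φ`,
its functor `ℋ (ℋ C) → ℋ C` sends `V` to the module
`c ↦ {v ∈ V (𝕐 c) | ⟨v, v⟩ is the image under 𝕐 of an endomorphism of c}`, with the action and the scalar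
product induced by those of `V`, and an operator `h` to its restriction, and if the isomorphism between
`H` and the restriction of `𝕐 H` is the one of the Yoneda lemma, which identifies `m ∈ H c` with the
operator `𝕐 c → H` given by `m`. -/
def IsRestriction {C : Type u} [CStarCategory.{u, v} C]
    (P : PreComplete (SmallHilbertModule C)) : Prop :=
  ∃ φ : ∀ (V : SmallHilbertModule (SmallHilbertModule C)) (c : C),
      (P.L.obj V).Elem c →ₗ[ℂ] V.Elem (yoneda c),
    (∀ V (c d : C) (m : (P.L.obj V).Elem c) (g : Hom d c),
      φ V d ((P.L.obj V).act m g) = V.act (φ V c m) (yonedaMap g)) ∧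
    (∀ V (c d : C) (m : (P.L.obj V).Elem c) (m' : (P.L.obj V).Elem d),
      V.inner (φ V c m) (φ V d m') = yonedaMap ((P.L.obj V).inner m m')) ∧
    (∀ V (c : C) (v : V.Elem (yoneda c)),
      (∃ m, φ V c m = v) ↔ ∃ g : Hom c c, V.inner v v = yonedaMap g) ∧
    (∀ V W (h : Hom V W) (c : C) (m : (P.L.obj V).Elem c),
      φ W c (SmallHilbertModule.opApp (P.L.map h) m) =
        SmallHilbertModule.opApp h (φ V c m)) ∧
    ∀ (H : SmallHilbertModule C) (c : C) (m : H.Elem c),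
      φ (yoneda H) c (SmallHilbertModule.opApp (P.unit H) m) = elemOp m

/-- The condition (C1), or separation condition: a morphism on `L H` which vanishes on `H` is zero. -/
def C1 : Prop :=
  ∀ (H : SmallHilbertModule C) (A : C) (l : Hom (P.L.obj H) A),
    (∀ (B : C) (b : H.Elem B), l ⊚ P.embed b = 0) → l = 0

/-- The condition (C2): the functor `L : ℋ C → C` is continuous, where `ℋ C` carries the restriction
structure. -/
def C2 : Prop :=
  ∃ Q : PreComplete (SmallHilbertModule C), Q.IsRestriction ∧ IsContinuous Q P P.L

/-- The condition (C3): a hereditary subalgebra which contains a weakly dense hereditary subalgebra is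
weakly dense. -/
def C3 : Prop :=
  ∀ (X : C) (𝒜 ℬ : HereditarySubalgebra X), 𝒜.carrier ≤ ℬ.carrier →
    P.IsWeaklyDense 𝒜 → P.IsWeaklyDense ℬ

/-- The condition (C4): if `f : A → L B` and `g : B → L A` are bounded linear maps with
`⟨f a, b⟩ = ⟨a, g b⟩` for all `a` in `A` and `b` in `B`, then `f` extends to an operator
`t : L A → L B`. -/
def C4 : Prop :=
  ∀ (A B : SmallHilbertModule C)
    (f : BoundedMap A.toHilbertModule (yoneda (P.L.obj B)).toHilbertModule)
    (g : BoundedMap B.toHilbertModule (yoneda (P.L.obj A)).toHilbertModule),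
    (∀ (X Y : C) (a : A.Elem X) (b : B.Elem Y),
      (yoneda (P.L.obj B)).inner (app f a) (P.embed b) =
        (yoneda (P.L.obj A)).inner (P.embed a) (app g b)) →
    ∃ t : Hom (yoneda (P.L.obj A)) (yoneda (P.L.obj B)),
      ∀ (X : C) (a : A.Elem X), SmallHilbertModule.opApp t (P.embed a) = app f a

end PreComplete

end

open BanachStarCategory CStarCategory

/-!
The restriction `R(V)` of a module `V` over `ℋ C` consists, over `c`, of the `v ∈ V(𝕐 c)` whose scalar
square is represented by an endomorphism of `c`. By the estimate `‖v - v e‖² ≤ ‖p - p e‖ (1 + ‖e‖)`,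
where `p = ⟨v, v⟩`, and the approximate units of `C(c, c)`, these `v` are exactly the limits of elements
of the form `v ∘ 𝕐 e` (`mem_restrElems_iff`). Hence they form a closed subspace, their scalar products
are represented by morphisms of `C`, bounded linear maps preserve them, and for `V = 𝕐 H` they are the
operators `m̂`, with `m` in `H` (`mem_restrElems_yoneda_iff`). This makes `R` a pre-complete structure.

Now let `L` be such a structure, with `i` the embeddings `V → 𝕐 (L V)`. If `m ∈ L V` corresponds to
`v ∈ V(𝕐 c)`, then `i(v) = m̂` (`RestrictionData.embed_val`). This gives the four conditions.

* (C1) An operator on `L V` is determined by its composites with the `m̂ = i(v)`.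
* (C4) The values of `f` on `L A` are represented by elements of `L B`, and those of `g` on `L B` by
  elements of `L A`, so that `f` and `g` give adjoint operators between `L A` and `L B`.
* (C3) If a module `S` over `ℋ C` embeds into `𝕐 X` and its image contains all `m̂` for `m` in `X`, then
  `L S ≃ X`, compatibly with the embeddings (`RestrictionData.exists_unitary_of_embedding`). Therefore
  `𝒜` is weakly dense if and only if `𝒜 X` contains all `m̂`, a condition inherited by larger algebras.
* (C2) Let `Q` be the restriction structure on `ℋ (ℋ C)`. No tensor product is needed to construct
  `ℋ L`: the submodule of `𝕐 (L (Q V))` generated by the morphisms `L (i x)`, for the generators `x` of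
  `V`, has the required scalar products, because `i(x)^* i(y) = ⟨x, y⟩`. It contains all `m̂`
  (`RestrictionData.elemOp_mem_imageElems`), so that `L ((ℋ L) V) ≃ L (Q V)` by the previous criterion.
-/

/-! ### Approximate units -/

namespace BanachStarCategory

variable {C : Type u} [BanachStarCategory.{u, v} C]

lemma comp_sub {A B D : C} (p : Hom B D) (q r : Hom A B) : p ⊚ (q - r) = p ⊚ q - p ⊚ r := by
  rw [eq_sub_iff_add_eq, ← comp_add, sub_add_cancel]

end BanachStarCategory

namespace CStarCategory

variable {C : Type u} [CStarCategory.{u, v} C]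

lemma exists_norm_sub_comp_lt {A : C} (g : Hom A A) {ε : ℝ} (hε : 0 < ε) :
    ∃ e : Hom A A, ‖e‖ ≤ 1 ∧ ‖g - g ⊚ e‖ < ε := by
  let _ := endAlgebra A norm_adj_comp_self
  let _ := CStarAlgebra.spectralOrder (Hom A A)
  let _ := CStarAlgebra.spectralOrderedRing (Hom A A)
  have hu := CStarAlgebra.increasingApproximateUnit (Hom A A)
  have : (CStarAlgebra.approximateUnit (Hom A A)).NeBot := hu.neBot
  have h : Filter.Tendsto (fun e : Hom A A => g * e) (CStarAlgebra.approximateUnit (Hom A A))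
      (nhds g) := hu.tendsto_mul_left g
  obtain ⟨e, he, he'⟩ :=
    (hu.eventually_norm.and (h.eventually (Metric.ball_mem_nhds g hε))).exists
  refine ⟨e, he, ?_⟩
  rw [← dist_eq_norm, dist_comm]
  exact he'

/-- Positivity of a self-adjoint `g` follows from that of all `e^* g e`, as `g` is a limit of
such. -/
lemma isPositiveEnd_of_conj {A : C} {g : Hom A A} (hg : adj g = g)
    (h : ∀ e : Hom A A, IsPositiveEnd (adj e ⊚ g ⊚ e)) : IsPositiveEnd g := by
  let _ := endAlgebra A norm_adj_comp_self
  let _ := CStarAlgebra.spectralOrder (Hom A A)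
  let _ := CStarAlgebra.spectralOrderedRing (Hom A A)
  suffices 0 ≤ g from CStarAlgebra.nonneg_iff_eq_star_mul_self.mp this
  have hc : IsClosed {a : Hom A A | 0 ≤ a} := CStarAlgebra.isClosed_nonneg
  refine hc.closure_subset (Metric.mem_closure_iff.mpr fun ε hε => ?_)
  obtain ⟨e, he, hd⟩ := exists_norm_sub_comp_lt g (half_pos hε)
  refine ⟨adj e ⊚ g ⊚ e, ?_, ?_⟩
  · obtain ⟨b, hb⟩ := h e
    rw [hb]
    exact star_mul_self_nonneg b
  · have e1 : g - adj e ⊚ g ⊚ e = adj (g - g ⊚ e) + adj e ⊚ (g - g ⊚ e) := by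
      rw [adj_sub, adj_comp, hg, comp_sub]
      abel
    rw [dist_eq_norm, e1]
    calc _ ≤ ‖adj (g - g ⊚ e)‖ + ‖adj e ⊚ (g - g ⊚ e)‖ := norm_add_le _ _
      _ ≤ ‖g - g ⊚ e‖ + ‖e‖ * ‖g - g ⊚ e‖ := by
        gcongr
        · exact (norm_adj _).le
        · exact (norm_comp_le _ _).trans_eq (by rw [norm_adj])
      _ ≤ ‖g - g ⊚ e‖ + 1 * ‖g - g ⊚ e‖ := by gcongr
      _ < ε := by linarith

end CStarCategory

/-! ### Hilbert modules and operators -/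

namespace HilbertModule

variable {C : Type u} [CStarCategory.{u, v} C] (M : HilbertModule C)

lemma inner_ext {A : C} {a a' : M.Elem A}
    (h : ∀ (B : C) (b : M.Elem B), M.inner b a = M.inner b a') : a = a' := by
  rw [← sub_eq_zero]
  refine M.eq_zero_of_inner_self ?_
  rw [M.inner_sub, h, sub_self]

lemma ext_inner {A : C} {a a' : M.Elem A}
    (h : ∀ (B : C) (b : M.Elem B), M.inner a b = M.inner a' b) : a = a' :=
  M.inner_ext fun B b => by rw [M.inner_symm, h, ← M.inner_symm]

/-- The linear map `f ↦ a ∘ f`, as a continuous map. -/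
noncomputable def orbitCLM {A : C} (a : M.Elem A) (B : C) : Hom B A →L[ℂ] M.Elem B :=
  LinearMap.mkContinuous
    { toFun := fun f => M.act a f
      map_add' := fun f g => M.act_add a f g
      map_smul' := fun c f => M.act_smul c a f } ‖a‖ (fun f => M.norm_act_le a f)

lemma norm_sub_act_sq_le {A : C} (v : M.Elem A) (e : Hom A A) :
    ‖v - M.act v e‖ ^ 2 ≤ ‖M.inner v v - M.inner v v ⊚ e‖ * (1 + ‖e‖) := by
  set d := M.inner v v - M.inner v v ⊚ e with hd
  have h : M.inner (v - M.act v e) (v - M.act v e) = d - adj e ⊚ d := by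
    rw [M.sub_inner, M.act_inner, M.inner_sub, M.inner_act, ← hd]
  rw [M.norm_sq, h]
  calc _ ≤ ‖d‖ + ‖adj e ⊚ d‖ := norm_sub_le _ _
    _ ≤ ‖d‖ + ‖e‖ * ‖d‖ := by
      gcongr
      exact (norm_comp_le _ _).trans_eq (by rw [norm_adj])
    _ = _ := by ring

/-- An element `v` is approximated by `v ∘ e` for contractions `e` in a subset of the endomorphisms
as soon as `⟨v, v⟩` is. -/
lemma exists_norm_sub_act_lt_of {A : C} (v : M.Elem A) {s : Set (Hom A A)}
    (h : ∀ ε > 0, ∃ e ∈ s, ‖e‖ ≤ 1 ∧ ‖M.inner v v - M.inner v v ⊚ e‖ < ε) {ε : ℝ} (hε : 0 < ε) :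
    ∃ e ∈ s, ‖e‖ ≤ 1 ∧ ‖v - M.act v e‖ < ε := by
  obtain ⟨e, hs, he, hd⟩ := h (ε ^ 2 / 2) (by positivity)
  refine ⟨e, hs, he, lt_of_pow_lt_pow_left₀ 2 hε.le ?_⟩
  calc _ ≤ _ := M.norm_sub_act_sq_le v e
    _ ≤ ‖M.inner v v - M.inner v v ⊚ e‖ * 2 := by gcongr; linarith
    _ < _ := by linarith

lemma exists_norm_sub_act_lt {A : C} (v : M.Elem A) {ε : ℝ} (hε : 0 < ε) :
    ∃ e : Hom A A, ‖e‖ ≤ 1 ∧ ‖v - M.act v e‖ < ε := by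
  obtain ⟨e, -, he⟩ := M.exists_norm_sub_act_lt_of v (s := Set.univ) (fun ε hε => by
    obtain ⟨e, he⟩ := exists_norm_sub_comp_lt (M.inner v v) hε
    exact ⟨e, trivial, he⟩) hε
  exact ⟨e, he⟩

end HilbertModule

/-- A family spanning a dense subset of a subspace `p` of the ambient space spans a dense subset of
the subspace `p`. -/
lemma Submodule.topologicalClosure_span_eq_top_of_subset {E : Type*} [NormedAddCommGroup E]
    [NormedSpace ℂ E] (p : Submodule ℂ E) (s : Set p)
    (h : p ≤ (Submodule.span ℂ (Subtype.val '' s)).topologicalClosure) :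
    (Submodule.span ℂ s).topologicalClosure = ⊤ := by
  rw [eq_top_iff]
  intro x _
  change x ∈ closure ((Submodule.span ℂ s : Submodule ℂ p) : Set p)
  rw [closure_subtype]
  have h1 : (Subtype.val '' ((Submodule.span ℂ s : Submodule ℂ p) : Set p)) =
      (Submodule.span ℂ (Subtype.val '' s) : Submodule ℂ E) := by
    have := Submodule.map_span p.subtype s
    exact congrArg (fun q : Submodule ℂ E => (q : Set E)) this
  rw [h1]
  exact h x.2

namespace SmallHilbertModule

variable {C : Type u} [CStarCategory.{u, v} C] {X Y Z : SmallHilbertModule C}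

lemma mem_of_gen {A : C} {T : Submodule ℂ (X.Elem A)} (hT : IsClosed (T : Set (X.Elem A)))
    (h : ∀ (x : X.Gen) (f : Hom A (X.src x)), X.act (X.gen x) f ∈ T) (a : X.Elem A) : a ∈ T := by
  have h1 : a ∈ (Submodule.span ℂ
      {a : X.Elem A | ∃ (x : X.Gen) (f : Hom A (X.src x)),
        a = X.act (X.gen x) f}).topologicalClosure := by
    rw [X.dense A]; trivial
  refine Submodule.topologicalClosure_minimal _ (Submodule.span_le.mpr ?_) hT h1
  rintro _ ⟨x, f, rfl⟩
  exact h x f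

lemma opApp_act (f : Hom X Y) {A B : C} (a : X.Elem A) (g : Hom B A) :
    opApp f (X.act a g) = Y.act (opApp f a) g := app_act _ a g

lemma add_opApp (f g : Hom X Y) {A : C} (a : X.Elem A) :
    opApp (f + g) a = opApp f a + opApp g a := by
  change app (Op.map (f + g : Op X Y)) a = _
  rw [Op.map_add]
  rfl

lemma smul_opApp (c : ℂ) (f : Hom X Y) {A : C} (a : X.Elem A) :
    opApp (c • f) a = c • opApp f a := by
  change app (Op.map (c • f : Op X Y)) a = _
  rw [Op.map_smul]
  rfl

lemma opApp_one {A : C} (a : X.Elem A) : opApp (UnitalCStarCategory.one X) a = a := by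
  change app (Op.map (Op.mk _ _ _)) a = _
  rw [Op.map_mk]
  rfl

lemma norm_opApp_le (f : Hom X Y) {A : C} (a : X.Elem A) : ‖opApp f a‖ ≤ ‖f‖ * ‖a‖ :=
  norm_app_le _ a

lemma adj_eq_of_inner {f : Hom X Y} {g : Hom Y X}
    (h : ∀ (A B : C) (a : X.Elem A) (b : Y.Elem B),
      X.inner a (opApp g b) = Y.inner (opApp f a) b) : adj f = g :=
  opApp_ext fun B b => X.inner_ext fun A a => by rw [h, inner_opApp]

/-- A norm-bounded function on elements which has an adjoint is an operator: linearity and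
naturality follow from the adjunction. -/
lemma exists_op_of_adjoint (f : ∀ A : C, X.Elem A → Y.Elem A) (g : ∀ A : C, Y.Elem A → X.Elem A)
    (h : ∀ (A B : C) (a : X.Elem A) (b : Y.Elem B), X.inner a (g B b) = Y.inner (f A a) b)
    (K : ℝ) (hK : 0 ≤ K) (hf : ∀ A a, ‖f A a‖ ≤ K * ‖a‖) :
    ∃ l : Hom X Y, (∀ (A : C) (a : X.Elem A), opApp l a = f A a) ∧
      ∀ (A : C) (b : Y.Elem A), opApp (adj l) b = g A b := by
  have hg : ∀ A b, ‖g A b‖ ≤ K * ‖b‖ := by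
    intro A b
    have h1 : ‖g A b‖ ^ 2 ≤ K * ‖g A b‖ * ‖b‖ := by
      rw [X.norm_sq, h]
      exact (Y.norm_inner_le _ _).trans (mul_le_mul_of_nonneg_right (hf _ _) (norm_nonneg _))
    by_cases h0 : ‖g A b‖ = 0
    · rw [h0]; positivity
    have : 0 < ‖g A b‖ := lt_of_le_of_ne (norm_nonneg _) (Ne.symm h0)
    nlinarith
  let F : BoundedMap X.toHilbertModule Y.toHilbertModule := mkBounded f
    (fun A a b => Y.ext_inner fun B c => by
      rw [Y.add_inner, ← h, ← h, ← h, X.add_inner])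
    (fun A c a => Y.ext_inner fun B b => by rw [Y.smul_inner, ← h, ← h, X.smul_inner])
    (fun A B a k => Y.ext_inner fun D b => by rw [Y.act_inner, ← h, ← h, X.act_inner]) K hK hf
  let G : BoundedMap Y.toHilbertModule X.toHilbertModule := mkBounded g
    (fun A a b => X.inner_ext fun B c => by
      rw [X.inner_add, h, h, h, Y.inner_add])
    (fun A c a => X.inner_ext fun B b => by rw [X.inner_smul, h, h, Y.inner_smul])
    (fun A B a k => X.inner_ext fun D b => by rw [X.inner_act, h, h, Y.inner_act]) K hK hg
  have hFG : IsAdjointPair F G := h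
  have h1 : ∀ (A : C) (a : X.Elem A), opApp (Op.mk F G hFG : Hom X Y) a = f A a := by
    intro A a
    change app (Op.map (Op.mk F G hFG)) a = _
    rw [Op.map_mk]
    rfl
  refine ⟨Op.mk F G hFG, h1, fun A b => X.inner_ext fun B c => ?_⟩
  rw [inner_opApp, h1, h]

/-- A surjection on elements which preserves scalar products is a unitary. -/
lemma exists_unitary (f : ∀ A : C, X.Elem A → Y.Elem A)
    (h : ∀ (A B : C) (a : X.Elem A) (b : X.Elem B), Y.inner (f A a) (f B b) = X.inner a b)
    (hs : ∀ A, Function.Surjective (f A)) :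
    ∃ l : Hom X Y, IsUnitary l ∧ ∀ (A : C) (a : X.Elem A), opApp l a = f A a := by
  choose g hg using hs
  obtain ⟨l, hl, hl'⟩ := exists_op_of_adjoint f g (fun A B a b => by rw [← h, hg]) 1 zero_le_one
    (fun A a => by
      rw [one_mul, ← pow_le_pow_iff_left₀ (norm_nonneg _) (norm_nonneg _) two_ne_zero, Y.norm_sq,
        X.norm_sq, h])
  refine ⟨l, ⟨opApp_ext fun A a => ?_, opApp_ext fun A a => ?_⟩, hl⟩
  · rw [opApp_one]
    refine X.inner_ext fun B b => ?_
    rw [opApp_comp, inner_opApp, hl, hl, h]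
  · rw [opApp_one, opApp_comp, hl, hl', hg]

end SmallHilbertModule

namespace CStarCategory

open SmallHilbertModule

variable {C : Type u} [CStarCategory.{u, v} C]

lemma IsUnitary.adj {D : Type u} [UnitalCStarCategory.{u, v} D] {A B : D} {f : Hom A B}
    (h : IsUnitary f) : IsUnitary (BanachStarCategory.adj f) :=
  ⟨by rw [adj_adj]; exact h.2, by rw [adj_adj]; exact h.1⟩

lemma IsUnitary.adj_comp_eq {D : Type u} [UnitalCStarCategory.{u, v} D] {A B E : D}
    {f : Hom A B} (h : IsUnitary f) {p : Hom E B} {q : Hom E A} (e : p = f ⊚ q) :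
    BanachStarCategory.adj f ⊚ p = q := by
  rw [e, ← comp_assoc, h.1, UnitalCStarCategory.one_comp]

lemma IsUnitary.comp_adj_eq {D : Type u} [UnitalCStarCategory.{u, v} D] {A B A' B' : D}
    {f : Hom A B} {f' : Hom A' B'} (h : IsUnitary f) (h' : IsUnitary f') {p : Hom A A'}
    {q : Hom B B'} (e : f' ⊚ p = q ⊚ f) :
    p ⊚ BanachStarCategory.adj f = BanachStarCategory.adj f' ⊚ q :=
  (h'.adj_comp_eq (by
    rw [← comp_assoc, e, comp_assoc, h.2, UnitalCStarCategory.comp_one])).symm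

/-! ### Operators given by elements -/

section elemOp

variable {H K : SmallHilbertModule C} {A B : C}

lemma opApp_elemOp (a : H.Elem A) (f : Hom B A) :
    opApp (elemOp a) (show (yoneda A).Elem B from f) = H.act a f :=
  congrArg (fun m => app m (show (yoneda A).Elem B from f)) (Op.map_mk (X := yoneda A) _ _ _)

lemma comp_elemOp (h : Hom H K) (a : H.Elem A) : h ⊚ elemOp a = elemOp (opApp h a) :=
  opApp_ext fun B f => by
    rw [opApp_comp]
    exact (congrArg (opApp h) (opApp_elemOp a f)).trans
      ((opApp_act h a f).trans (opApp_elemOp (opApp h a) f).symm)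

lemma elemOp_act (a : H.Elem A) (f : Hom B A) : elemOp (H.act a f) = elemOp a ⊚ yonedaMap f :=
  (congrArg elemOp (opApp_elemOp a f).symm).trans (comp_elemOp (H := yoneda A) (elemOp a) f).symm

lemma adj_elemOp_opApp (a : H.Elem A) (b : H.Elem B) :
    opApp (adj (elemOp a)) b = H.inner a b := by
  refine (yoneda A).inner_ext fun D d => ?_
  rw [inner_opApp]
  exact (congrArg (fun z => H.inner z b) (opApp_elemOp a d)).trans (H.act_inner a b d)

lemma adj_elemOp_comp (a : H.Elem A) (b : H.Elem B) :
    adj (elemOp a) ⊚ elemOp b = yonedaMap (H.inner a b) := by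
  rw [comp_elemOp, adj_elemOp_opApp]
  rfl

lemma elemOp_add (a b : H.Elem A) : elemOp (a + b) = elemOp a + elemOp b :=
  opApp_ext fun B f => by
    rw [add_opApp]
    exact (opApp_elemOp (a + b) f).trans ((H.add_act a b f).trans
      (congrArg₂ (· + ·) (opApp_elemOp a f) (opApp_elemOp b f)).symm)

lemma elemOp_smul (c : ℂ) (a : H.Elem A) : elemOp (c • a) = c • elemOp a :=
  opApp_ext fun B f => by
    rw [smul_opApp]
    exact (opApp_elemOp (c • a) f).trans ((H.smul_act c a f).trans
      (congrArg (c • ·) (opApp_elemOp a f)).symm)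

lemma norm_elemOp (a : H.Elem A) : ‖elemOp a‖ = ‖a‖ := by
  refine le_antisymm ?_ ?_
  · refine norm_le_of_app (norm_nonneg a) fun B f => ?_
    exact (congrArg norm (opApp_elemOp a f)).trans_le (H.norm_act_le a f)
  · refine le_of_forall_pos_le_add fun ε hε => ?_
    obtain ⟨e, he, hd⟩ := H.exists_norm_sub_act_lt a hε
    have h1 : ‖H.act a e‖ ≤ ‖elemOp a‖ := by
      rw [← opApp_elemOp]
      refine (norm_opApp_le _ _).trans ?_
      exact mul_le_of_le_one_right (norm_nonneg _) he
    calc ‖a‖ = ‖H.act a e + (a - H.act a e)‖ := by rw [add_sub_cancel]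
      _ ≤ _ := (norm_add_le _ _).trans (by linarith)

/-- Sending `a` to the operator `f ↦ a ∘ f` is isometric. -/
noncomputable def elemOpLI (H : SmallHilbertModule C) (A : C) :
    H.Elem A →ₗᵢ[ℂ] Hom (yoneda A) H where
  toFun := elemOp
  map_add' := elemOp_add
  map_smul' := elemOp_smul
  norm_map' := norm_elemOp

lemma elemOp_injective : Function.Injective (elemOp : H.Elem A → Hom (yoneda A) H) :=
  (elemOpLI H A).injective

lemma isClosed_range_elemOp (H : SmallHilbertModule C) (A : C) :
    IsClosed ((LinearMap.range (elemOpLI H A).toLinearMap : Submodule ℂ (Hom (yoneda A) H)) :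
      Set (Hom (yoneda A) H)) := by
  rw [LinearMap.coe_range]
  exact (elemOpLI H A).isometry.isClosedEmbedding.isClosed_range

lemma yonedaMap_injective : Function.Injective (yonedaMap : Hom A B → _) :=
  elemOp_injective (H := yoneda B)

lemma norm_yonedaMap (f : Hom A B) : ‖yonedaMap f‖ = ‖f‖ := norm_elemOp (H := yoneda B) f

lemma yonedaMap_comp {D : C} (g : Hom B D) (f : Hom A B) :
    yonedaMap (g ⊚ f) = yonedaMap g ⊚ yonedaMap f := elemOp_act (H := yoneda D) g f

lemma adj_yonedaMap (f : Hom A B) : adj (yonedaMap f) = yonedaMap (adj f) :=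
  adj_eq_of_inner fun D E a b => by
    refine ((congrArg ((yoneda A).inner a) (opApp_elemOp (H := yoneda A) (adj f) b)).trans ?_).trans
      (congrArg (fun z => (yoneda B).inner z b) (opApp_elemOp (H := yoneda B) f a)).symm
    have h : ∀ (a : Hom D A) (b : Hom E B), adj a ⊚ adj f ⊚ b = adj (f ⊚ a) ⊚ b := fun a b => by
      rw [adj_comp, comp_assoc]
    exact h a b

end elemOp

lemma elemOp_one {D : Type u} [UnitalCStarCategory.{u, v} D] (A : D) :
    elemOp (H := yoneda A) (UnitalCStarCategory.one A) = UnitalCStarCategory.one (yoneda A) :=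
  opApp_ext fun B f => by
    rw [opApp_one]
    exact (opApp_elemOp (H := yoneda A) _ f).trans (UnitalCStarCategory.one_comp (f : Hom B A))

end CStarCategory

/-! ### The restriction of a module over `ℋ C` to `C` -/

namespace CStarCategory

open SmallHilbertModule

variable {C : Type u} [CStarCategory.{u, v} C]

/-- The elements of `R(V)` over `c`, encoded as the closed linear span of the elements `v ∘ 𝕐 e`,
which makes the linear structure evident; `mem_restrElems_iff` is the description by scalar products. -/
def restrElems (V : SmallHilbertModule (SmallHilbertModule C)) (c : C) :
    Submodule ℂ (V.Elem (yoneda c)) :=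
  (Submodule.span ℂ {w | ∃ (v : V.Elem (yoneda c)) (e : Hom c c),
    w = V.act v (yonedaMap e)}).topologicalClosure

variable {V W : SmallHilbertModule (SmallHilbertModule C)}

lemma isClosed_restrElems (c : C) : IsClosed (restrElems V c : Set (V.Elem (yoneda c))) :=
  Submodule.isClosed_topologicalClosure _

lemma act_yonedaMap_mem_restrElems {c : C} (v : V.Elem (yoneda c)) (e : Hom c c) :
    V.act v (yonedaMap e) ∈ restrElems V c :=
  Submodule.le_topologicalClosure _ (Submodule.subset_span ⟨v, e, rfl⟩)

lemma restrElems_le {c : C} {T : Submodule ℂ (V.Elem (yoneda c))}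
    (hT : IsClosed (T : Set (V.Elem (yoneda c))))
    (h : ∀ (v : V.Elem (yoneda c)) (e : Hom c c), V.act v (yonedaMap e) ∈ T) :
    restrElems V c ≤ T := by
  refine Submodule.topologicalClosure_minimal _ (Submodule.span_le.mpr ?_) hT
  rintro _ ⟨v, e, rfl⟩
  exact h v e

lemma exists_inner_eq_elemOp {c : C} {v : V.Elem (yoneda c)} (hv : v ∈ restrElems V c)
    {K : SmallHilbertModule C} (w : V.Elem K) : ∃ m : K.Elem c, V.inner w v = elemOp m := by
  have h : restrElems V c ≤ (LinearMap.range (elemOpLI K c).toLinearMap).comap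
      (V.innerCLM w (yoneda c)).toLinearMap := by
    refine restrElems_le ((isClosed_range_elemOp K c).preimage (V.innerCLM w (yoneda c)).continuous)
      fun v e => ?_
    refine ⟨opApp (V.inner w v) (show (yoneda c).Elem c from e), ?_⟩
    exact (comp_elemOp (V.inner w v) (show (yoneda c).Elem c from e)).symm.trans
      (V.inner_act w v (yonedaMap e)).symm
  obtain ⟨m, hm⟩ := h hv
  exact ⟨m, hm.symm⟩

lemma mem_restrElems_iff {c : C} {v : V.Elem (yoneda c)} :
    v ∈ restrElems V c ↔ ∃ g : Hom c c, V.inner v v = yonedaMap g := by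
  refine ⟨fun hv => exists_inner_eq_elemOp hv v, ?_⟩
  rintro ⟨g, hg⟩
  refine (isClosed_restrElems c).closure_subset (Metric.mem_closure_iff.mpr fun ε hε => ?_)
  obtain ⟨_, ⟨e, rfl⟩, -, hd⟩ := V.exists_norm_sub_act_lt_of v (s := Set.range yonedaMap)
    (fun ε hε => by
      obtain ⟨e, he, hd⟩ := exists_norm_sub_comp_lt g hε
      refine ⟨_, ⟨e, rfl⟩, by rwa [norm_yonedaMap], ?_⟩
      have e1 : yonedaMap g - yonedaMap (g ⊚ e) = yonedaMap (g - g ⊚ e) :=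
        ((elemOpLI (yoneda c) c).map_sub g (g ⊚ e)).symm
      rwa [hg, ← yonedaMap_comp, e1, norm_yonedaMap]) hε
  exact ⟨_, act_yonedaMap_mem_restrElems v e, by rwa [dist_eq_norm]⟩

/-- The elements of `R(𝕐 H)` are those of `H`: the Yoneda lemma. -/
lemma mem_restrElems_yoneda_iff {H : SmallHilbertModule C} {c : C} {k : Hom (yoneda c) H} :
    k ∈ restrElems (yoneda H) c ↔ ∃ m : H.Elem c, elemOp m = k := by
  constructor
  · intro hk
    obtain ⟨m, hm⟩ := exists_inner_eq_elemOp hk (UnitalCStarCategory.one H : Hom H H)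
    refine ⟨m, hm.symm.trans ?_⟩
    have h1 : adj (UnitalCStarCategory.one H : Hom H H) = UnitalCStarCategory.one H :=
      adj_eq_of_inner fun A B a b => by rw [opApp_one, opApp_one]
    refine (congrArg (· ⊚ k) h1).trans ?_
    exact UnitalCStarCategory.one_comp k
  · rintro ⟨m, rfl⟩
    exact mem_restrElems_iff.mpr ⟨H.inner m m, adj_elemOp_comp m m⟩

lemma act_elemOp_mem_restrElems {c : C} {K : SmallHilbertModule C} (w : V.Elem K) (m : K.Elem c) :
    V.act w (elemOp m) ∈ restrElems V c := by
  refine mem_restrElems_iff.mpr ⟨K.inner m (opApp (V.inner w w) m), ?_⟩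
  rw [V.inner_act, V.act_inner, comp_assoc, comp_elemOp, adj_elemOp_comp]

lemma act_mem_restrElems {c d : C} {v : V.Elem (yoneda c)} (hv : v ∈ restrElems V c) (g : Hom d c) :
    V.act v (yonedaMap g) ∈ restrElems V d := by
  obtain ⟨p, hp⟩ := mem_restrElems_iff.mp hv
  refine mem_restrElems_iff.mpr ⟨adj g ⊚ p ⊚ g, ?_⟩
  rw [V.inner_act, V.act_inner, hp, yonedaMap_comp, yonedaMap_comp, ← comp_assoc, adj_yonedaMap]

lemma app_mem_restrElems (f : BoundedMap V.toHilbertModule W.toHilbertModule) {c : C}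
    {v : V.Elem (yoneda c)} (hv : v ∈ restrElems V c) : app f v ∈ restrElems W c := by
  have h : restrElems V c ≤ (restrElems W c).comap (f.1 (yoneda c)).toLinearMap := by
    refine restrElems_le ((isClosed_restrElems c).preimage (f.1 (yoneda c)).continuous)
      fun v e => ?_
    have := act_yonedaMap_mem_restrElems (app f v) e
    rwa [← app_act] at this
  exact h hv

lemma opApp_mem_restrElems (f : Hom V W) {c : C} {v : V.Elem (yoneda c)}
    (hv : v ∈ restrElems V c) : opApp f v ∈ restrElems W c := app_mem_restrElems _ hv

/-- The scalar product of `R(V)`: the morphism represented by the scalar product of `V`. -/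
noncomputable def restrInner {c d : C} (w : restrElems V d) (v : restrElems V c) : Hom c d :=
  (exists_inner_eq_elemOp v.2 w.1).choose

lemma yonedaMap_restrInner {c d : C} (w : restrElems V d) (v : restrElems V c) :
    yonedaMap (restrInner w v) = V.inner w.1 v.1 :=
  (exists_inner_eq_elemOp v.2 w.1).choose_spec.symm

lemma yonedaMap_add {A B : C} (f g : Hom A B) : yonedaMap (f + g) = yonedaMap f + yonedaMap g :=
  elemOp_add (H := yoneda B) f g

lemma yonedaMap_smul {A B : C} (c : ℂ) (f : Hom A B) : yonedaMap (c • f) = c • yonedaMap f :=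
  elemOp_smul (H := yoneda B) c f

/-- If `𝕐 g = k^* k`, then `e^* g e` is the scalar square of the value `k e`. -/
lemma isPositiveEnd_of_yonedaMap {c : C} {g : Hom c c} (h : IsPositiveEnd (yonedaMap g)) :
    IsPositiveEnd g := by
  obtain ⟨k, hk⟩ := h
  refine isPositiveEnd_of_conj (yonedaMap_injective ?_) fun e =>
    ⟨opApp k (show (yoneda c).Elem c from e), ?_⟩
  · rw [← adj_yonedaMap, hk, adj_comp, adj_adj]
  · have h1 := inner_opApp k (show (yoneda c).Elem c from e)
      (opApp k (show (yoneda c).Elem c from e))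
    rw [← opApp_comp, ← hk] at h1
    exact (congrArg ((yoneda c).inner (show (yoneda c).Elem c from e))
      (opApp_elemOp (H := yoneda c) g e)).symm.trans h1

/-- The Hilbert `C`-module `R(V)`. -/
noncomputable def restrModule (V : SmallHilbertModule (SmallHilbertModule C)) :
    HilbertModule C where
  Elem c := restrElems V c
  completeSpace c := (isClosed_restrElems c).completeSpace_coe
  act v g := ⟨V.act v.1 (yonedaMap g), act_mem_restrElems v.2 g⟩
  inner w v := restrInner w v
  act_add a f g := Subtype.ext ((congrArg (V.act a.1) (yonedaMap_add f g)).trans (V.act_add _ _ _))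
  add_act a b f := Subtype.ext (V.add_act a.1 b.1 _)
  act_smul c a f := Subtype.ext
    ((congrArg (V.act a.1) (yonedaMap_smul c f)).trans (V.act_smul _ _ _))
  smul_act c a f := Subtype.ext (V.smul_act c a.1 _)
  act_comp a f g := Subtype.ext
    ((congrArg (V.act a.1) (yonedaMap_comp f g)).trans (V.act_comp _ _ _))
  inner_symm b a := yonedaMap_injective (by
    rw [← adj_yonedaMap, yonedaMap_restrInner, yonedaMap_restrInner, V.inner_symm])
  inner_add b a a' := yonedaMap_injective (by
    rw [yonedaMap_add, yonedaMap_restrInner, yonedaMap_restrInner, yonedaMap_restrInner,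
      ← V.inner_add]
    rfl)
  inner_smul c b a := yonedaMap_injective (by
    rw [yonedaMap_smul, yonedaMap_restrInner, yonedaMap_restrInner, ← V.inner_smul]
    rfl)
  inner_act b a f := yonedaMap_injective (by
    rw [yonedaMap_comp, yonedaMap_restrInner, yonedaMap_restrInner, ← V.inner_act])
  inner_self_pos a := isPositiveEnd_of_yonedaMap (by
    rw [yonedaMap_restrInner]
    exact V.inner_self_pos a.1)
  norm_sq a := by
    rw [← norm_yonedaMap, yonedaMap_restrInner, ← V.norm_sq]
    rfl

/-- `R(V)` as a small module: the generators are the `x ∘ ŷ` with `x` a generator of `V` over `K`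
and `y` a generator of `K`. -/
noncomputable def restr (V : SmallHilbertModule (SmallHilbertModule C)) : SmallHilbertModule C where
  toHilbertModule := restrModule V
  Gen := Σ x : V.Gen, (V.src x).Gen
  src p := (V.src p.1).src p.2
  gen p := ⟨V.act (V.gen p.1) (elemOp ((V.src p.1).gen p.2)), act_elemOp_mem_restrElems _ _⟩
  dense c := by
    refine Submodule.topologicalClosure_span_eq_top_of_subset (restrElems V c) _ ?_
    set T := (Submodule.span ℂ (Subtype.val '' {a : restrElems V c |
      ∃ (p : Σ x : V.Gen, (V.src x).Gen) (f : Hom c ((V.src p.1).src p.2)),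
        a = ⟨V.act (V.act (V.gen p.1) (elemOp ((V.src p.1).gen p.2))) (yonedaMap f),
          act_mem_restrElems (act_elemOp_mem_restrElems _ _) f⟩})).topologicalClosure
      with hT
    have hc : IsClosed (T : Set (V.Elem (yoneda c))) := Submodule.isClosed_topologicalClosure _
    have h1 : ∀ (x : V.Gen) (m : (V.src x).Elem c), V.act (V.gen x) (elemOp m) ∈ T := by
      intro x m
      let F : (V.src x).Elem c →L[ℂ] V.Elem (yoneda c) :=
        (V.orbitCLM (V.gen x) (yoneda c)).comp (elemOpLI (V.src x) c).toContinuousLinearMap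
      refine SmallHilbertModule.mem_of_gen (X := V.src x) (T := T.comap F.toLinearMap)
        (hc.preimage F.continuous) (fun y f => ?_) m
      refine Submodule.le_topologicalClosure _
        (Submodule.subset_span ⟨⟨_, act_mem_restrElems (act_elemOp_mem_restrElems _ _) f⟩,
          ⟨⟨x, y⟩, f, rfl⟩, ?_⟩)
      change V.act (V.act _ _) _ = V.act (V.gen x) (elemOp _)
      rw [elemOp_act, V.act_comp]
    refine restrElems_le hc fun v e => ?_
    refine SmallHilbertModule.mem_of_gen (X := V)
      (T := T.comap (V.actCLM (yonedaMap e)).toLinearMap)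
      (hc.preimage (V.actCLM (yonedaMap e)).continuous) (fun x f => ?_) v
    have h2 : V.act (V.act (V.gen x) f) (yonedaMap e) =
        V.act (V.gen x) (elemOp (opApp f (show (yoneda c).Elem c from e))) := by
      rw [← V.act_comp, ← comp_elemOp]
      rfl
    change V.act (V.act (V.gen x) f) (yonedaMap e) ∈ T
    rw [h2]
    exact h1 x _

/-- The inclusion `R(V)(c) ⊆ V(𝕐 c)`. -/
noncomputable def restrVal {c : C} : (restr V).Elem c →ₗ[ℂ] V.Elem (yoneda c) :=
  (restrElems V c).subtype

lemma restrVal_injective {c : C} : Function.Injective (restrVal (V := V) (c := c)) :=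
  Subtype.val_injective

lemma restrVal_mem {c : C} (m : (restr V).Elem c) : restrVal m ∈ restrElems V c := m.2

lemma exists_restrVal_eq {c : C} {v : V.Elem (yoneda c)} (hv : v ∈ restrElems V c) :
    ∃ m : (restr V).Elem c, restrVal m = v := ⟨⟨v, hv⟩, rfl⟩

lemma inner_restrVal {c d : C} (m : (restr V).Elem c) (n : (restr V).Elem d) :
    V.inner (restrVal m) (restrVal n) = yonedaMap ((restr V).inner m n) :=
  (yonedaMap_restrInner _ _).symm

lemma norm_restrVal {c : C} (m : (restr V).Elem c) : ‖restrVal m‖ = ‖m‖ := rfl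

lemma exists_restrOp (h : Hom V W) : ∃ l : Hom (restr V) (restr W),
    ∀ (c : C) (m : (restr V).Elem c), restrVal (opApp l m) = opApp h (restrVal m) := by
  choose f hf using fun (c : C) (m : (restr V).Elem c) =>
    exists_restrVal_eq (opApp_mem_restrElems h (restrVal_mem m))
  choose g hg using fun (c : C) (m : (restr W).Elem c) =>
    exists_restrVal_eq (opApp_mem_restrElems (adj h) (restrVal_mem m))
  obtain ⟨l, hl, -⟩ := exists_op_of_adjoint (X := restr V) (Y := restr W) f g
    (fun c d a b => yonedaMap_injective (by
      rw [← inner_restrVal, ← inner_restrVal, hf, hg, inner_opApp]))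
    ‖h‖ (norm_nonneg h) (fun c a => by
      rw [← norm_restrVal, ← norm_restrVal, hf]
      exact norm_opApp_le h _)
  exact ⟨l, fun c m => by rw [hl, hf]⟩

/-- The restriction of an operator. -/
noncomputable def restrOp (h : Hom V W) : Hom (restr V) (restr W) := (exists_restrOp h).choose

lemma restrVal_opApp_restrOp (h : Hom V W) {c : C} (m : (restr V).Elem c) :
    restrVal (opApp (restrOp h) m) = opApp h (restrVal m) :=
  (exists_restrOp h).choose_spec c m

lemma op_ext_restrVal {H : SmallHilbertModule C} {f g : Hom H (restr V)}
    (h : ∀ (c : C) (m : H.Elem c), restrVal (opApp f m) = restrVal (opApp g m)) : f = g :=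
  opApp_ext fun c m => restrVal_injective (h c m)

lemma exists_restrUnit (H : SmallHilbertModule C) :
    ∃ l : Hom H (restr (yoneda H)), IsUnitary l ∧
      ∀ (c : C) (m : H.Elem c), restrVal (opApp l m) = elemOp m := by
  choose f hf using fun (c : C) (m : H.Elem c) =>
    exists_restrVal_eq (V := yoneda H) (mem_restrElems_yoneda_iff.mpr ⟨m, rfl⟩)
  obtain ⟨l, hl, hl'⟩ := exists_unitary (X := H) (Y := restr (yoneda H)) f
    (fun c d m n => yonedaMap_injective (by
      rw [← inner_restrVal, hf, hf]
      exact adj_elemOp_comp m n))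
    (fun c v => by
      obtain ⟨m, hm⟩ := mem_restrElems_yoneda_iff.mp (restrVal_mem v)
      exact ⟨m, restrVal_injective ((hf c m).trans hm)⟩)
  exact ⟨l, hl, fun c m => by rw [hl', hf]⟩

/-- The unitary `H → R(𝕐 H)`, `m ↦ m̂`, of the Yoneda lemma. -/
noncomputable def restrUnit (H : SmallHilbertModule C) : Hom H (restr (yoneda H)) :=
  (exists_restrUnit H).choose

lemma restrVal_opApp_restrUnit {H : SmallHilbertModule C} {c : C} (m : H.Elem c) :
    restrVal (opApp (restrUnit H) m) = elemOp m :=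
  (exists_restrUnit H).choose_spec.2 c m

/-- The restriction functor `R : ℋ (ℋ C) → ℋ C`. -/
noncomputable def restrFunctor (C : Type u) [CStarCategory.{u, v} C] :
    CStarFunctor (SmallHilbertModule (SmallHilbertModule C)) (SmallHilbertModule C) where
  obj := restr
  map {V W} :=
    { toFun := restrOp
      map_add' := fun f g => op_ext_restrVal fun c m => by
        rw [add_opApp, map_add, restrVal_opApp_restrOp, restrVal_opApp_restrOp,
          restrVal_opApp_restrOp, add_opApp]
      map_smul' := fun r f => op_ext_restrVal fun c m => by
        rw [RingHom.id_apply, smul_opApp, map_smul, restrVal_opApp_restrOp,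
          restrVal_opApp_restrOp, smul_opApp] }
  map_comp g f := op_ext_restrVal fun c m => by
    change restrVal (opApp (restrOp _) m) = restrVal (opApp (restrOp _ ⊚ restrOp _) m)
    rw [opApp_comp, restrVal_opApp_restrOp, restrVal_opApp_restrOp, restrVal_opApp_restrOp,
      opApp_comp]
  map_adj {V W} f := (adj_eq_of_inner (X := restr V) (Y := restr W) fun c d m n =>
    yonedaMap_injective (by
      change yonedaMap ((restr V).inner m (opApp (restrOp _) n)) =
        yonedaMap ((restr W).inner (opApp (restrOp _) m) n)
      rw [← inner_restrVal, ← inner_restrVal, restrVal_opApp_restrOp, restrVal_opApp_restrOp,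
        inner_opApp])).symm

/-- The restriction functor and the Yoneda isomorphism as a pre-complete structure on `ℋ C`. -/
noncomputable def restrPreComplete (C : Type u) [CStarCategory.{u, v} C] :
    PreComplete (SmallHilbertModule C) where
  L := restrFunctor C
  map_one V := op_ext_restrVal fun c m => by
    exact (restrVal_opApp_restrOp _ m).trans
      ((opApp_one (restrVal m)).trans (congrArg restrVal (opApp_one (X := restr V) m)).symm)
  unit := restrUnit
  unit_isUnitary H := (exists_restrUnit H).choose_spec.1
  unit_natural {H K} f := op_ext_restrVal fun c m => by
    change restrVal (opApp (restrOp (yonedaMap f) ⊚ restrUnit H) m) =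
      restrVal (opApp (restrUnit K ⊚ f) m)
    rw [opApp_comp, opApp_comp, restrVal_opApp_restrOp, restrVal_opApp_restrUnit,
      restrVal_opApp_restrUnit]
    exact (opApp_elemOp (H := yoneda K) f (elemOp m)).trans (comp_elemOp f m)

lemma restrPreComplete_isRestriction (C : Type u) [CStarCategory.{u, v} C] :
    (restrPreComplete C).IsRestriction := by
  refine ⟨fun V c => restrVal, fun V c d m g => rfl, fun V c d => inner_restrVal, fun V c v => ?_,
    fun V W h c => restrVal_opApp_restrOp h, fun H c => restrVal_opApp_restrUnit⟩
  rw [← mem_restrElems_iff]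
  exact ⟨fun ⟨m, hm⟩ => hm ▸ restrVal_mem m, exists_restrVal_eq⟩

end CStarCategory

/-! ### Pre-complete structures -/

namespace PreComplete

open SmallHilbertModule

variable {C : Type u} [UnitalCStarCategory.{u, v} C] (P : PreComplete C)

lemma embed_act {H : SmallHilbertModule C} {A B : C} (a : H.Elem A) (f : Hom B A) :
    P.embed (H.act a f) = P.embed a ⊚ f := by
  rw [embed, embed, elemOp_act, P.L.map_comp, comp_assoc, P.unit_natural, comp_assoc]

lemma map_comp_embed {H K : SmallHilbertModule C} (h : Hom H K) {A : C} (a : H.Elem A) :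
    P.L.map h ⊚ P.embed a = P.embed (opApp h a) := by
  rw [embed, embed, ← comp_assoc, ← P.L.map_comp, comp_elemOp]

lemma adj_embed_comp_embed {H : SmallHilbertModule C} {A B : C} (b : H.Elem B) (a : H.Elem A) :
    adj (P.embed b) ⊚ P.embed a = H.inner b a := by
  rw [embed, embed, adj_comp, comp_assoc, ← comp_assoc (adj (P.L.map _)), ← P.L.map_adj,
    ← P.L.map_comp, adj_elemOp_comp, P.unit_natural, ← comp_assoc, (P.unit_isUnitary B).1,
    UnitalCStarCategory.one_comp]

lemma embed_one (A : C) :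
    P.embed (H := yoneda A) (show (yoneda A).Elem A from UnitalCStarCategory.one A) = P.unit A :=
  (congrArg (fun k => P.L.map k ⊚ P.unit A) (elemOp_one A)).trans
    (by rw [P.map_one, UnitalCStarCategory.one_comp])

lemma norm_embed {H : SmallHilbertModule C} {A : C} (a : H.Elem A) : ‖P.embed a‖ = ‖a‖ := by
  rw [← pow_left_inj₀ (norm_nonneg _) (norm_nonneg _) two_ne_zero,
    ← CStarCategory.norm_adj_comp_self,
    adj_embed_comp_embed, H.norm_sq]

/-- The embedding `H(A) → Hom A (L H)` as an isometry. -/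
noncomputable def embedLI (H : SmallHilbertModule C) (A : C) :
    H.Elem A →ₗᵢ[ℂ] Hom A (P.L.obj H) where
  toFun := P.embed
  map_add' a b := by rw [embed, elemOp_add, map_add, add_comp]; rfl
  map_smul' c a := by rw [embed, elemOp_smul, map_smul, smul_comp]; rfl
  norm_map' := P.norm_embed

end PreComplete

namespace CStarFunctor

lemma norm_map_le {C : Type u} {D : Type w} [CStarCategory.{u, v} C] [CStarCategory.{w, v} D]
    (F : CStarFunctor C D) {A B : C} (f : Hom A B) : ‖F.map f‖ ≤ ‖f‖ := by
  let _ := endAlgebra A (CStarCategory.norm_adj_comp_self (A := A) (B := A))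
  let _ := endAlgebra (F.obj A) (CStarCategory.norm_adj_comp_self (A := F.obj A) (B := F.obj A))
  let φ : Hom A A →⋆ₙₐ[ℂ] Hom (F.obj A) (F.obj A) :=
    { toFun := fun g => F.map g
      map_smul' := fun c g => F.map.map_smul c g
      map_zero' := F.map.map_zero
      map_add' := fun g h => F.map.map_add g h
      map_mul' := fun g h => F.map_comp g h
      map_star' := fun g => F.map_adj g }
  have h : ‖F.map (adj f ⊚ f)‖ ≤ ‖adj f ⊚ f‖ := NonUnitalStarAlgHom.norm_apply_le φ (adj f ⊚ f)
  rw [F.map_comp, F.map_adj, norm_adj_comp_self, norm_adj_comp_self] at h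
  exact (pow_le_pow_iff_left₀ (norm_nonneg _) (norm_nonneg _) two_ne_zero).mp h

/-- The action of a `C^*`-functor on morphisms, as a continuous linear map. -/
noncomputable def mapCLM {C : Type u} {D : Type w} [CStarCategory.{u, v} C] [CStarCategory.{w, v} D]
    (F : CStarFunctor C D) (A B : C) : Hom A B →L[ℂ] Hom (F.obj A) (F.obj B) :=
  F.map.mkContinuous 1 fun f => by rw [one_mul]; exact F.norm_map_le f

end CStarFunctor

/-! ### The induced functor on modules over a pre-complete category -/

namespace PreComplete

open SmallHilbertModule

variable {C : Type u} {D : Type w} [UnitalCStarCategory.{u, v} C] [UnitalCStarCategory.{w, v} D]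
  (Q : PreComplete C) (f : CStarFunctor C D)

/-- The elements over `K` of the submodule of `𝕐 (f (L V))` generated by the morphisms `f (i x)`,
for the generators `x` of `V`. -/
def imageElems (V : SmallHilbertModule C) (K : D) : Submodule ℂ (Hom K (f.obj (Q.L.obj V))) :=
  (Submodule.span ℂ {k | ∃ (x : V.Gen) (g : Hom K (f.obj (V.src x))),
    k = f.map (Q.embed (V.gen x)) ⊚ g}).topologicalClosure

variable {V W : SmallHilbertModule C}

lemma isClosed_imageElems (K : D) :
    IsClosed (Q.imageElems f V K : Set (Hom K (f.obj (Q.L.obj V)))) :=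
  Submodule.isClosed_topologicalClosure _

lemma imageElems_le {K : D} {T : Submodule ℂ (Hom K (f.obj (Q.L.obj V)))}
    (hT : IsClosed (T : Set (Hom K (f.obj (Q.L.obj V)))))
    (h : ∀ (x : V.Gen) (g : Hom K (f.obj (V.src x))), f.map (Q.embed (V.gen x)) ⊚ g ∈ T) :
    Q.imageElems f V K ≤ T := by
  refine Submodule.topologicalClosure_minimal _ (Submodule.span_le.mpr ?_) hT
  rintro _ ⟨x, g, rfl⟩
  exact h x g

lemma map_embed_gen_comp_mem (x : V.Gen) {K : D} (g : Hom K (f.obj (V.src x))) :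
    f.map (Q.embed (V.gen x)) ⊚ g ∈ Q.imageElems f V K :=
  Submodule.le_topologicalClosure _ (Submodule.subset_span ⟨x, g, rfl⟩)

lemma map_embed_comp_mem {A : C} (a : V.Elem A) {K : D} (g : Hom K (f.obj A)) :
    f.map (Q.embed a) ⊚ g ∈ Q.imageElems f V K := by
  let F : V.Elem A →L[ℂ] Hom K (f.obj (Q.L.obj V)) :=
    ((yonedaModule (f.obj (Q.L.obj V))).actCLM g).comp
      ((f.mapCLM A (Q.L.obj V)).comp (Q.embedLI V A).toContinuousLinearMap)
  refine mem_of_gen (X := V) (T := (Q.imageElems f V K).comap F.toLinearMap)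
    ((Q.isClosed_imageElems f K).preimage F.continuous) (fun x h => ?_) a
  have e : f.map (Q.embed (V.act (V.gen x) h)) ⊚ g =
      f.map (Q.embed (V.gen x)) ⊚ f.map h ⊚ g := by
    rw [embed_act, f.map_comp, comp_assoc]
  change f.map (Q.embed (V.act (V.gen x) h)) ⊚ g ∈ Q.imageElems f V K
  rw [e]
  exact Q.map_embed_gen_comp_mem f x _

lemma comp_mem_imageElems {K K' : D} {k : Hom K (f.obj (Q.L.obj V))}
    (hk : k ∈ Q.imageElems f V K) (g : Hom K' K) : k ⊚ g ∈ Q.imageElems f V K' := by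
  let F : Hom K (f.obj (Q.L.obj V)) →L[ℂ] Hom K' (f.obj (Q.L.obj V)) :=
    (yonedaModule (f.obj (Q.L.obj V))).actCLM g
  have h : Q.imageElems f V K ≤ (Q.imageElems f V K').comap F.toLinearMap := by
    refine Q.imageElems_le f ((Q.isClosed_imageElems f K').preimage F.continuous) fun x h => ?_
    change (f.map (Q.embed (V.gen x)) ⊚ h) ⊚ g ∈ Q.imageElems f V K'
    rw [comp_assoc]
    exact Q.map_embed_gen_comp_mem f x _
  exact h hk

lemma map_comp_mem_imageElems (h : Hom V W) {K : D} {k : Hom K (f.obj (Q.L.obj V))}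
    (hk : k ∈ Q.imageElems f V K) : f.map (Q.L.map h) ⊚ k ∈ Q.imageElems f W K := by
  let F : Hom K (f.obj (Q.L.obj V)) →L[ℂ] Hom K (f.obj (Q.L.obj W)) :=
    (yonedaModule (f.obj (Q.L.obj W))).orbitCLM (f.map (Q.L.map h)) K
  have h : Q.imageElems f V K ≤ (Q.imageElems f W K).comap F.toLinearMap := by
    refine Q.imageElems_le f ((Q.isClosed_imageElems f K).preimage F.continuous) fun x g => ?_
    change f.map (Q.L.map h) ⊚ f.map (Q.embed (V.gen x)) ⊚ g ∈ Q.imageElems f W K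
    rw [← comp_assoc, ← f.map_comp, map_comp_embed]
    exact Q.map_embed_comp_mem f _ g
  exact h hk

/-- The submodule of `𝕐 (f (L V))` generated by the morphisms `f (i x)`, for the generators `x` of
`V`. -/
noncomputable def imageModule (V : SmallHilbertModule C) : SmallHilbertModule D where
  Elem K := Q.imageElems f V K
  completeSpace K := (Q.isClosed_imageElems f K).completeSpace_coe
  act k g := ⟨k.1 ⊚ g, Q.comp_mem_imageElems f k.2 g⟩
  inner b a := adj b.1 ⊚ a.1
  act_add a f g := Subtype.ext (comp_add a.1 f g)
  add_act a b f := Subtype.ext (add_comp a.1 b.1 f)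
  act_smul c a f := Subtype.ext (comp_smul c a.1 f)
  smul_act c a f := Subtype.ext (smul_comp c a.1 f)
  act_comp a f g := Subtype.ext (comp_assoc a.1 f g).symm
  inner_symm b a := by rw [adj_comp, adj_adj]
  inner_add b a a' := comp_add _ a.1 a'.1
  inner_smul c b a := comp_smul c _ a.1
  inner_act b a f := (comp_assoc _ a.1 f).symm
  inner_self_pos a := adj_comp_self_pos a.1
  norm_sq a := (norm_adj_comp_self a.1).symm
  Gen := V.Gen
  src x := f.obj (V.src x)
  gen x := ⟨f.map (Q.embed (V.gen x)), by
    have := Q.map_embed_gen_comp_mem f x (UnitalCStarCategory.one (f.obj (V.src x)))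
    rwa [UnitalCStarCategory.comp_one] at this⟩
  dense K := by
    refine Submodule.topologicalClosure_span_eq_top_of_subset (Q.imageElems f V K) _ ?_
    refine Q.imageElems_le f (Submodule.isClosed_topologicalClosure _) fun x g => ?_
    exact Submodule.le_topologicalClosure _ (Submodule.subset_span
      ⟨⟨_, Q.map_embed_gen_comp_mem f x g⟩, ⟨x, g, rfl⟩, rfl⟩)

/-- The inclusion of the module generated by the `f (i x)` into `𝕐 (f (L V))`. -/
noncomputable def imageVal {K : D} : (Q.imageModule f V).Elem K →ₗ[ℂ] Hom K (f.obj (Q.L.obj V)) :=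
  (Q.imageElems f V K).subtype

lemma imageVal_injective {K : D} : Function.Injective (Q.imageVal f (V := V) (K := K)) :=
  Subtype.val_injective

lemma imageVal_mem {K : D} (k : (Q.imageModule f V).Elem K) :
    Q.imageVal f k ∈ Q.imageElems f V K := k.2

lemma exists_imageVal_eq {K : D} {k : Hom K (f.obj (Q.L.obj V))} (hk : k ∈ Q.imageElems f V K) :
    ∃ m : (Q.imageModule f V).Elem K, Q.imageVal f m = k := ⟨⟨k, hk⟩, rfl⟩

lemma adj_imageVal_comp {K K' : D} (k : (Q.imageModule f V).Elem K)
    (k' : (Q.imageModule f V).Elem K') :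
    adj (Q.imageVal f k) ⊚ Q.imageVal f k' = (Q.imageModule f V).inner k k' := rfl

/-- The generator `f (i x)`. -/
noncomputable def imageGen (x : V.Gen) : (Q.imageModule f V).Elem (f.obj (V.src x)) :=
  (Q.imageModule f V).gen x

lemma imageVal_imageGen (x : V.Gen) :
    Q.imageVal f (Q.imageGen f x) = f.map (Q.embed (V.gen x)) := rfl

lemma norm_imageVal {K : D} (k : (Q.imageModule f V).Elem K) : ‖Q.imageVal f k‖ = ‖k‖ := rfl

lemma exists_imageOp (h : Hom V W) : ∃ l : Hom (Q.imageModule f V) (Q.imageModule f W),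
    ∀ (K : D) (k : (Q.imageModule f V).Elem K),
      Q.imageVal f (opApp l k) = f.map (Q.L.map h) ⊚ Q.imageVal f k := by
  choose p hp using fun (K : D) (k : (Q.imageModule f V).Elem K) =>
    Q.exists_imageVal_eq f (Q.map_comp_mem_imageElems f h (Q.imageVal_mem f k))
  choose q hq using fun (K : D) (k : (Q.imageModule f W).Elem K) =>
    Q.exists_imageVal_eq f (Q.map_comp_mem_imageElems f (adj h) (Q.imageVal_mem f k))
  obtain ⟨l, hl, -⟩ := exists_op_of_adjoint (X := Q.imageModule f V) (Y := Q.imageModule f W) p q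
    (fun K K' a b => by
      rw [← adj_imageVal_comp, ← adj_imageVal_comp, hp, hq, adj_comp, comp_assoc, ← f.map_adj,
        ← Q.L.map_adj])
    ‖f.map (Q.L.map h)‖ (norm_nonneg _) (fun K k => by
      rw [← norm_imageVal, ← norm_imageVal, hp]
      exact norm_comp_le _ _)
  exact ⟨l, fun K k => by rw [hl, hp]⟩

/-- The operator obtained from `h : V → W` by restricting the composition with `f (L h)`. -/
noncomputable def imageOp (h : Hom V W) : Hom (Q.imageModule f V) (Q.imageModule f W) :=
  (Q.exists_imageOp f h).choose

lemma imageVal_opApp_imageOp (h : Hom V W) {K : D} (k : (Q.imageModule f V).Elem K) :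
    Q.imageVal f (opApp (Q.imageOp f h) k) = f.map (Q.L.map h) ⊚ Q.imageVal f k :=
  (Q.exists_imageOp f h).choose_spec K k

lemma op_ext_imageVal {H : SmallHilbertModule D} {p q : Hom H (Q.imageModule f V)}
    (h : ∀ (K : D) (m : H.Elem K), Q.imageVal f (opApp p m) = Q.imageVal f (opApp q m)) : p = q :=
  opApp_ext fun K m => Q.imageVal_injective f (h K m)

/-- The functor `ℋ f`, for `f` defined on a pre-complete category, realised by submodules of
representable modules. -/
noncomputable def imageExtension : ModuleExtension f where
  functor :=
    { obj := Q.imageModule f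
      map := fun {V W} =>
        { toFun := Q.imageOp f
          map_add' := fun g h => Q.op_ext_imageVal f fun K k => by
            rw [add_opApp, map_add, imageVal_opApp_imageOp, imageVal_opApp_imageOp,
              imageVal_opApp_imageOp, map_add, map_add, add_comp]
          map_smul' := fun c g => Q.op_ext_imageVal f fun K k => by
            rw [RingHom.id_apply, smul_opApp, map_smul, imageVal_opApp_imageOp,
              imageVal_opApp_imageOp, map_smul, map_smul, smul_comp] }
      map_comp := fun g h => Q.op_ext_imageVal f fun K k => by
        change Q.imageVal f (opApp (Q.imageOp f _) k) =
          Q.imageVal f (opApp (Q.imageOp f _ ⊚ Q.imageOp f _) k)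
        rw [opApp_comp, imageVal_opApp_imageOp, imageVal_opApp_imageOp, imageVal_opApp_imageOp,
          Q.L.map_comp, f.map_comp, comp_assoc]
      map_adj := fun {V W} h => (adj_eq_of_inner (X := Q.imageModule f V)
        (Y := Q.imageModule f W) fun K K' a b => by
          change (Q.imageModule f V).inner a (opApp (Q.imageOp f _) b) =
            (Q.imageModule f W).inner (opApp (Q.imageOp f _) a) b
          rw [← adj_imageVal_comp, ← adj_imageVal_comp, imageVal_opApp_imageOp,
            imageVal_opApp_imageOp, adj_comp, comp_assoc, ← f.map_adj, ← Q.L.map_adj]).symm }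
  elem V x := Q.imageGen f x
  inner_elem V x y := by
    change adj (f.map (Q.embed (V.gen x))) ⊚ f.map (Q.embed (V.gen y)) = _
    rw [← f.map_adj, ← f.map_comp, adj_embed_comp_embed]
  dense V K := (Q.imageModule f V).dense K
  map_elem {V W} h x y := by
    change (Q.imageModule f W).inner (Q.imageGen f y) (opApp (Q.imageOp f h) (Q.imageGen f x)) = _
    rw [← adj_imageVal_comp, imageVal_opApp_imageOp, imageVal_imageGen, imageVal_imageGen,
      ← f.map_comp, map_comp_embed, ← f.map_adj, ← f.map_comp, adj_embed_comp_embed]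

end PreComplete

/-! ### Consequences of the restriction property -/

/-- The data exhibiting a pre-complete structure on `ℋ C` as the restriction structure: the
inclusions `val : (L V)(c) → V(𝕐 c)`. -/
structure RestrictionData {C : Type u} [CStarCategory.{u, v} C]
    (P : PreComplete (SmallHilbertModule C)) where
  val : ∀ (V : SmallHilbertModule (SmallHilbertModule C)) (c : C),
    (P.L.obj V).Elem c →ₗ[ℂ] V.Elem (yoneda c)
  val_act : ∀ V (c d : C) (m : (P.L.obj V).Elem c) (g : Hom d c),
    val V d ((P.L.obj V).act m g) = V.act (val V c m) (yonedaMap g)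
  inner_val : ∀ V (c d : C) (m : (P.L.obj V).Elem c) (m' : (P.L.obj V).Elem d),
    V.inner (val V c m) (val V d m') = yonedaMap ((P.L.obj V).inner m m')
  exists_val_eq : ∀ V (c : C) (v : V.Elem (yoneda c)),
    (∃ m, val V c m = v) ↔ ∃ g : Hom c c, V.inner v v = yonedaMap g
  val_map : ∀ V W (h : Hom V W) (c : C) (m : (P.L.obj V).Elem c),
    val W c (SmallHilbertModule.opApp (P.L.map h) m) = SmallHilbertModule.opApp h (val V c m)
  val_unit : ∀ (H : SmallHilbertModule C) (c : C) (m : H.Elem c),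
    val (yoneda H) c (SmallHilbertModule.opApp (P.unit H) m) = elemOp m

namespace RestrictionData

open SmallHilbertModule

variable {C : Type u} [CStarCategory.{u, v} C] {P : PreComplete (SmallHilbertModule C)}
  {V : SmallHilbertModule (SmallHilbertModule C)} {c : C}

lemma _root_.PreComplete.IsRestriction.exists_data (h : P.IsRestriction) :
    Nonempty (RestrictionData P) := by
  obtain ⟨φ, h1, h2, h3, h4, h5⟩ := h
  exact ⟨⟨φ, h1, h2, h3, h4, h5⟩⟩

lemma norm_val (r : RestrictionData P) (m : (P.L.obj V).Elem c) : ‖r.val V c m‖ = ‖m‖ := by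
  rw [← pow_left_inj₀ (norm_nonneg _) (norm_nonneg _) two_ne_zero, V.norm_sq, r.inner_val,
    norm_yonedaMap, ← (P.L.obj V).norm_sq]

lemma val_injective (r : RestrictionData P) : Function.Injective (r.val V c) := by
  refine (injective_iff_map_eq_zero _).mpr fun m hm => ?_
  rw [← norm_eq_zero, ← r.norm_val, hm, norm_zero]

lemma val_mem (r : RestrictionData P) (m : (P.L.obj V).Elem c) : r.val V c m ∈ restrElems V c :=
  mem_restrElems_iff.mpr ⟨_, r.inner_val V c c m m⟩

lemma val_opApp_embed (r : RestrictionData P) {K : SmallHilbertModule C} (a : V.Elem K)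
    (m : K.Elem c) : r.val V c (opApp (P.embed a) m) = V.act a (elemOp m) := by
  rw [PreComplete.embed, opApp_comp, r.val_map, r.val_unit]
  exact opApp_elemOp a (elemOp m)

/-- On the elements of `V` which lie in `L V`, the embedding `V → 𝕐 (L V)` is the Yoneda map. -/
lemma embed_val (r : RestrictionData P) (m : (P.L.obj V).Elem c) :
    P.embed (r.val V c m) = elemOp m :=
  opApp_ext fun d f => r.val_injective (by
    rw [r.val_opApp_embed]
    exact ((congrArg (r.val V d) (opApp_elemOp m f)).trans (r.val_act V c d m f)).symm)

/-- The operators `m̂`, for `m` an element of `L V`, are among the morphisms `i(b)`; so an operator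
on `L V` is determined by its composites with the latter. -/
lemma hom_ext (r : RestrictionData P) {K : SmallHilbertModule C} {l l' : Hom (P.L.obj V) K}
    (h : ∀ (A : SmallHilbertModule C) (b : V.Elem A), l ⊚ P.embed b = l' ⊚ P.embed b) : l = l' :=
  opApp_ext fun c m => elemOp_injective (by rw [← comp_elemOp, ← comp_elemOp, ← r.embed_val, h])

/-- A submodule of `𝕐 X`, given by an embedding `ι`, which contains all elements of `X` is sent by
`L` to a module isomorphic to `X`. -/
lemma exists_unitary_of_embedding (r : RestrictionData P) {X : SmallHilbertModule C}
    (ι : ∀ K, V.Elem K → Hom K X)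
    (hact : ∀ (K K' : SmallHilbertModule C) (s : V.Elem K) (k : Hom K' K),
      ι K' (V.act s k) = ι K s ⊚ k)
    (hinner : ∀ (K K' : SmallHilbertModule C) (s : V.Elem K) (t : V.Elem K'),
      adj (ι K s) ⊚ ι K' t = V.inner s t)
    (hX : ∀ (c : C) (m : X.Elem c), ∃ s : V.Elem (yoneda c), ι (yoneda c) s = elemOp m) :
    ∃ u : Hom (P.L.obj V) X, IsUnitary u ∧
      ∀ (K : SmallHilbertModule C) (s : V.Elem K), u ⊚ P.embed s = ι K s := by
  have hι : ∀ (c : C) (n : (P.L.obj V).Elem c), ∃ m : X.Elem c,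
      elemOp m = ι (yoneda c) (r.val V c n) := fun c n =>
    mem_restrElems_yoneda_iff.mp (mem_restrElems_iff.mpr
      ⟨(P.L.obj V).inner n n, (hinner _ _ _ _).trans (r.inner_val V c c n n)⟩)
  choose f hf using hι
  obtain ⟨u, hu, hu'⟩ := exists_unitary (X := P.L.obj V) (Y := X) f
    (fun c d m n => yonedaMap_injective (by
      rw [← adj_elemOp_comp, hf, hf, hinner, r.inner_val]))
    (fun c m => by
      obtain ⟨s, hs⟩ := hX c m
      obtain ⟨n, rfl⟩ := (r.exists_val_eq V c s).mpr
        ⟨X.inner m m, by rw [← hinner, hs, adj_elemOp_comp]⟩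
      exact ⟨n, elemOp_injective (by rw [hf, hs])⟩)
  refine ⟨u, hu, fun K s => opApp_ext fun c k => elemOp_injective ?_⟩
  rw [opApp_comp, hu', hf, r.val_opApp_embed, hact, comp_elemOp]

lemma c1 (r : RestrictionData P) : P.C1 := fun H A l h => r.hom_ext fun B b => by rw [h, zero_comp]

/-- `𝒜` is weakly dense exactly if `𝒜 X` contains all operators `m̂ : 𝕐 c → X`. -/
lemma isWeaklyDense_iff (r : RestrictionData P) {X : SmallHilbertModule C}
    (𝒜 : HereditarySubalgebra X) :
    P.IsWeaklyDense 𝒜 ↔ ∀ (c : C) (m : X.Elem c), elemOp m ∈ 𝒜.elems (yoneda c) := by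
  constructor
  · rintro ⟨u, hu, hu'⟩ c m
    have h := hu' (yoneda c) (r.val 𝒜.module c (opApp (adj u) m))
    rw [r.embed_val, comp_elemOp, ← opApp_comp, hu.2, opApp_one] at h
    rw [h]
    exact (show 𝒜.elems (yoneda c) from r.val 𝒜.module c (opApp (adj u) m)).2
  · intro h
    exact r.exists_unitary_of_embedding (V := 𝒜.module) (fun K (s : 𝒜.elems K) => s.1)
      (fun K K' s k => rfl) (fun K K' s t => rfl) (fun c m => ⟨⟨elemOp m, h c m⟩, rfl⟩)

lemma c3 (r : RestrictionData P) : P.C3 := by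
  intro X 𝒜 ℬ h h𝒜
  rw [r.isWeaklyDense_iff] at h𝒜 ⊢
  refine fun c m => closure_mono (Submodule.span_mono ?_) (h𝒜 c m)
  rintro _ ⟨a, ha, k, rfl⟩
  exact ⟨a, h ha, k, rfl⟩

/-- The values of `f` on elements of `L A` are represented by elements of `L B`, which gives the
operator `s : L A → L B`; its adjoint is obtained in the same way from `g`. -/
lemma c4 (r : RestrictionData P) : P.C4 := by
  intro A B f g h
  have hf : ∀ (c : C) (m : (P.L.obj A).Elem c), ∃ n : (P.L.obj B).Elem c,
      elemOp n = app f (r.val A c m) := fun c m =>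
    mem_restrElems_yoneda_iff.mp (app_mem_restrElems f (r.val_mem m))
  have hg : ∀ (c : C) (n : (P.L.obj B).Elem c), ∃ m : (P.L.obj A).Elem c,
      elemOp m = app g (r.val B c n) := fun c n =>
    mem_restrElems_yoneda_iff.mp (app_mem_restrElems g (r.val_mem n))
  choose p hp using hf
  choose q hq using hg
  obtain ⟨s, hs, -⟩ := exists_op_of_adjoint (X := P.L.obj A) (Y := P.L.obj B) p q
    (fun c d m n => yonedaMap_injective (by
      have h1 := h _ _ (r.val A c m) (r.val B d n)
      rw [← hp, ← hq, r.embed_val, r.embed_val] at h1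
      rw [← adj_elemOp_comp, ← adj_elemOp_comp]
      exact h1.symm))
    ‖f‖ (norm_nonneg f) (fun c m => by
      rw [← norm_elemOp, ← r.norm_val, hp]
      exact norm_app_le f _)
  refine ⟨yonedaMap s, fun X a => ?_⟩
  refine (opApp_elemOp (H := yoneda (P.L.obj B)) s (P.embed a)).trans ?_
  refine opApp_ext fun c x => elemOp_injective ?_
  have h1 : elemOp (opApp (s ⊚ P.embed a) x) = app f (A.act a (elemOp x)) := by
    rw [opApp_comp, hs, hp, r.val_opApp_embed]
  refine h1.trans ((app_act f a (elemOp x)).trans ?_)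
  exact comp_elemOp (app f a) x

/-- With `Q` the restriction structure on `ℋ (ℋ C)`, an element `m` of `L (Q V)` over `c` comes
from an element `v` of `V` over `𝕐 (𝕐 c)`, and `m̂` is the composite of the isomorphism
`𝕐 c ≃ L (𝕐 (𝕐 c))` with `L (i v)`; so the submodule of `𝕐 (L (Q V))` realising `(ℋ L) V` contains
all `m̂`. -/
lemma elemOp_mem_imageElems (r : RestrictionData P)
    {Q : PreComplete (SmallHilbertModule (SmallHilbertModule C))}
    (r' : RestrictionData Q) {V : SmallHilbertModule (SmallHilbertModule (SmallHilbertModule C))}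
    (m : (P.L.obj (Q.L.obj V)).Elem c) :
    elemOp m ∈ Q.imageElems P.L V (yoneda c) := by
  have h := Q.map_embed_comp_mem P.L (r'.val V (yoneda c) (r.val (Q.L.obj V) c m))
    (P.unit (yoneda c))
  rw [r'.embed_val] at h
  rwa [← r.embed_val]

lemma c2 (r : RestrictionData P) : P.C2 := by
  refine ⟨restrPreComplete (SmallHilbertModule C), restrPreComplete_isRestriction _, P.map_one,
    ?_⟩
  set Q := restrPreComplete (SmallHilbertModule C)
  obtain ⟨r'⟩ := (restrPreComplete_isRestriction (SmallHilbertModule C)).exists_data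
  choose u hu hu' using fun V => r.exists_unitary_of_embedding (V := Q.imageModule P.L V)
    (X := P.L.obj (Q.L.obj V)) (fun K s => Q.imageVal P.L s) (fun K K' s k => rfl)
    (fun K K' s t => rfl)
    (fun c m => Q.exists_imageVal_eq P.L (r.elemOp_mem_imageElems r' m))
  -- `u V : L ((ℋ L) V) → L (Q V)` commutes with the embeddings of `(ℋ L) V`, whence its naturality
  refine ⟨Q.imageExtension P.L, fun V => adj (u V), fun V => (hu V).adj, fun V W h => ?_,
    fun K => ?_⟩
  · refine (hu V).comp_adj_eq (hu W) (p := P.L.map (Q.imageOp P.L h)) (q := P.L.map (Q.L.map h))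
      (r.hom_ext fun A b => ?_)
    rw [comp_assoc, comp_assoc, hu', P.map_comp_embed, hu', Q.imageVal_opApp_imageOp]
  · refine (hu (yoneda K)).adj_comp_eq (p := P.L.map (Q.unit K))
      (q := P.embed (Q.imageGen P.L (V := yoneda K) (UnitalCStarCategory.one K))) ?_
    exact (congrArg P.L.map (Q.embed_one K).symm).trans (hu' (yoneda K) _
      (Q.imageGen P.L (V := yoneda K) (UnitalCStarCategory.one K))).symm

end RestrictionData

theorem mainTheorem6 (C : Type u) [CStarCategory.{u, v} C] :
    (∃ P : PreComplete (SmallHilbertModule C), P.IsRestriction) ∧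
    ∀ P : PreComplete (SmallHilbertModule C), P.IsRestriction → P.C1 ∧ P.C2 ∧ P.C3 ∧ P.C4 := by
  refine ⟨⟨restrPreComplete C, restrPreComplete_isRestriction C⟩, fun P hP => ?_⟩
  obtain ⟨r⟩ := hP.exists_data
  exact ⟨r.c1, r.c2, r.c3, r.c4⟩
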